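/- Let $\sigma>0$ and $C\in\mathbb R$, and for every $k\ge 0$ let $F_k\in C^\infty(\mathbb R^{k+1})$ be a function whose partial derivatives of every nonzero order are uniformly bounded. For $n\ge 2$ let $u^0=(u^0_i)_{i\in[n]}$ be a random vector and $Z=(z_{ii'})_{i,i'\in[n]}$ a random symmetric matrix (possibly dependent on each other), defined on a common probability space, with $$\mathbb E\exp\Bigl(\frac{\|u^0\|_2^2}{\sigma n}\Bigr)\le C,\qquad \max_{i}\mathbb E\exp\Bigl(\frac{|u^0_i|}{\sigma}\Bigr)\le C,\qquad \max_{i,i'}\mathbb E\exp\Bigl(\frac{|z_{ii'}|}{\sigma}\Bigr)\le C .$$ Let $A=(a_{ii'})_{i,i'\in[n]}$ be a random symmetric matrix, independent of $(u^0,Z)$, whose entries on and above the diagonal are independent and centered, each of them being $\sigma'$-subgaussian (that is, $\mathbb E e^{\lambda a_{ii'}}\le e^{\lambda^2\sigma'^2/2}$ for all $\lambda\in\mathbb R$) for some $0\le\sigma'\le\sigma$. For a symmetric $n\times n$ matrix $X$ put $X_n=X/\sqrt n$ and $\hat X_n=X/\sqrt n+Z/n$, and define the generalized AMP orbit by $u^{[0]}(X)=u^0$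 and, coordinate by coordinate, $$u^{[k+1]}(X)=F_k\bigl(\hat X_nu^{[k]}(X),u^{[k-1]}(X),\ldots,u^{[0]}(X)\bigr),\qquad k\ge 0 .$$ For a finite list $P$ of pairs $(i_r,i_r')\in[n]^2$ with $i_r<i_r'$, repetitions allowed, let $\partial_P$ denote the iterated partial derivative with respect to the entries $x_{i_ri_r'}$ of the symmetric matrix $X$ (with $u^0$ and $Z$ held fixed), taken with multiplicity and applied to each coordinate of a vector-valued function; let $|P|$ be the length of the list. Then for all $k\ge 0$, all real $p\ge 1$ and all $m\ge 0$ there are constants $\Gamma_{k,p,m},\Gamma'_{k,p,m},\Upsilon_{k,p,m}$, depending only on $k,p,m,\sigma,C$ and $(F_\ell)_{\ell\ge0}$, such that for every $n\ge 2$, all $u^0,Z,A$ as above, every $P$ with $|P|=m$ and every $i\in[n]$, $$\bigl(\mathbb E|\partial_Pu^{[k]}(A)_i|^p\bigr)^{1/p}\le\frac{\Gamma_{k,p,m}}{n^{m/2}},\qquad \bigl(\mathbb E|\partial_P(\hat A_nu^{[k]}(A))_i|^p\bigr)^{1/p}\le\frac{\Gamma'_{k,p,m}}{n^{m/2}},\qquad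 \bigl(\mathbb E|(A_n\,\partial_Pu^{[k]}(A))_i|^p\bigr)^{1/p}\le\frac{\Upsilon_{k,p,m}}{n^{m/2}} .$$ -/

import Mathlib

open MeasureTheory ProbabilityTheory
open scoped Matrix NNReal

noncomputable section

namespace AMP

/-- The matrix `X̂ₙ = X / √n + Z / n`. -/
def hat {n : ℕ} (X Z : Matrix (Fin n) (Fin n) ℝ) : Matrix (Fin n) (Fin n) ℝ :=
  (Real.sqrt n)⁻¹ • X + (n : ℝ)⁻¹ • Z

/-- The generalized AMP orbit `u^{[k]}(X)` started from the constant initialization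
`u^{[0]}(X) = u⁰`:
`u^{[k+1]}(X) = F_k (X̂ₙ u^{[k]}(X), u^{[k-1]}(X), …, u^{[0]}(X))`, coordinate by coordinate.
The arguments of `F k` are labelled by their index: the argument with label `k` (the last one)
is `X̂ₙ u^{[k]}(X)` and the argument with label `j < k` is `u^{[j]}(X)`. -/
def orbit {n : ℕ} (F : (k : ℕ) → (Fin (k + 1) → ℝ) → ℝ)
    (Z : Matrix (Fin n) (Fin n) ℝ) (u0 : Fin n → ℝ) (X : Matrix (Fin n) (Fin n) ℝ) :
    ℕ → Fin n → ℝ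
  | 0 => u0
  | k + 1 => fun i =>
      F k (Fin.snoc (α := fun _ => ℝ) (fun j : Fin k => orbit F Z u0 X j i)
        ((hat X Z *ᵥ orbit F Z u0 X k) i))
  termination_by k => k
  decreasing_by all_goals omega

/-- `f` is smooth and its derivatives of every nonzero order are uniformly bounded. -/
def SmoothBddDeriv {d : ℕ} (f : (Fin d → ℝ) → ℝ) : Prop :=
  ContDiff ℝ ((⊤ : ℕ∞) : WithTop ℕ∞) f ∧
    ∀ j : ℕ, 1 ≤ j → ∃ B : ℝ, ∀ x, ‖iteratedFDeriv ℝ j f x‖ ≤ B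

/-- The direction in the space of symmetric matrices that belongs to the coordinate
`x_{ii'}` with `i < i'` (the entries `(i, i')` and `(i', i)` vary together). -/
def entryDir {n : ℕ} (e : Fin n × Fin n) : Matrix (Fin n) (Fin n) ℝ :=
  Matrix.single e.1 e.2 1 + Matrix.single e.2 e.1 1

/-- The iterated partial derivative of `h` with respect to the entries `x_{ii'}` of a symmetric
matrix, for the pairs `(i, i')` in the list, counting multiplicities. All the directions are
symmetric, so that at a symmetric matrix only the values of `h` at symmetric matrices enter. -/
def partialDeriv {n : ℕ} :
    List (Fin n × Fin n) → (Matrix (Fin n) (Fin n) ℝ → ℝ) → Matrix (Fin n) (Fin n) ℝ → ℝ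
  | [], h => h
  | e :: L, h => fun X => lineDeriv ℝ (partialDeriv L h) X (entryDir e)

/-- The assumptions on the random initialization `u⁰` and the random symmetric signal matrix `Z`
in dimension `n`: exponential moments bounded by `C`. -/
structure IsSignal {Ω : Type*} [MeasurableSpace Ω] (μ : Measure Ω) {n : ℕ} (σ C : ℝ)
    (u0 : Ω → Fin n → ℝ) (Z : Ω → Matrix (Fin n) (Fin n) ℝ) : Prop where
  measurable_init : ∀ i, Measurable fun ω => u0 ω i
  measurable_signal : ∀ i j, Measurable fun ω => Z ω i j
  symm_signal : ∀ ω, (Z ω).IsSymm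
  norm_integrable : Integrable (fun ω => Real.exp ((∑ i, u0 ω i ^ 2) / (σ * n))) μ
  norm_le : ∫ ω, Real.exp ((∑ i, u0 ω i ^ 2) / (σ * n)) ∂μ ≤ C
  init_integrable : ∀ i, Integrable (fun ω => Real.exp (|u0 ω i| / σ)) μ
  init_le : ∀ i, ∫ ω, Real.exp (|u0 ω i| / σ) ∂μ ≤ C
  signal_integrable : ∀ i j, Integrable (fun ω => Real.exp (|Z ω i j| / σ)) μ
  signal_le : ∀ i j, ∫ ω, Real.exp (|Z ω i j| / σ) ∂μ ≤ C

/-- The class of noise matrices: random symmetric matrices whose entries on and above the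
diagonal are independent, centered and `σ'`-subgaussian for some `0 ≤ σ' ≤ σ`, and that are
independent of the pair `(u⁰, Z)`. -/
structure IsNoise {Ω : Type*} [MeasurableSpace Ω] (μ : Measure Ω) {n : ℕ} (σ : ℝ)
    (u0 : Ω → Fin n → ℝ) (Z A : Ω → Matrix (Fin n) (Fin n) ℝ) : Prop where
  measurable : ∀ i j, Measurable fun ω => A ω i j
  symm : ∀ ω, (A ω).IsSymm
  indep_entries :
    iIndepFun (fun (e : {e : Fin n × Fin n // e.1 ≤ e.2}) ω => A ω e.1.1 e.1.2) μ
  centered : ∀ i j, ∫ ω, A ω i j ∂μ = 0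
  subgaussian : ∀ i j, ∃ σ' : ℝ≥0, (σ' : ℝ) ≤ σ ∧
    HasSubgaussianMGF (fun ω => A ω i j) (σ' ^ 2) μ
  indep_signal :
    IndepFun (fun ω (e : Fin n × Fin n) => A ω e.1 e.2)
      (fun ω => (u0 ω, fun e : Fin n × Fin n => Z ω e.1 e.2)) μ

/-- The random variable `f` has a finite `p`-th moment and `(𝔼 |f| ^ p) ^ (1 / p) ≤ b`. -/
def MomentLE {Ω : Type*} [MeasurableSpace Ω] (μ : Measure Ω) (p : ℝ) (f : Ω → ℝ) (b : ℝ) :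
    Prop :=
  MemLp f (ENNReal.ofReal p) μ ∧ (∫ ω, |f ω| ^ p ∂μ) ^ (1 / p) ≤ b

end AMP

end

open scoped ENNReal

noncomputable section

namespace AMP

local notation "∞ₛ" => ((⊤ : ℕ∞) : WithTop ℕ∞)

universe u

variable {σ C : ℝ}

/-! Each derivative in a noise entry should cost a factor `n^{-1/2}`. Multiplying every derivative
by `√n` turns the claim into this: all scaled derivatives of the orbit have moments bounded
independently of `n`. Functions of noise, initialization and signal with this property (`Tame`) are
to be closed under every operation that builds the orbit. Sums, products (Leibniz and Hölder),
composition with `F_k` (chain rule, linear growth) and the mean `n⁻¹ ∑ z_{ij} u_j` are soft. The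
bounds are chosen before the model, so all constants are uniform.

The real issue is the row sum `n^{-1/2} ∑_j x_{ij} w_j`, whose weights depend on the noise. A scaled
derivative of a row sum is a row sum of differentiated weights plus at most two undifferentiated
weights, so it suffices to bound moments of row sums (`exists_abs_integral_prod_rowSum_le`). In a
mixed moment, expand one row sum over `l`. If `a_{il}` has not been used before, expand the
remaining integrand to first order in that entry (`Fresh.abs_integral_le`): the zeroth-order term
vanishes by independence and centering, and the remainder gains another `n^{-1/2}`. The `n` new
indices thus contribute `n · n^{-1/2} · n^{-1/2} = O(1)`, and the boundedly many used ones
contribute `O(n^{-1/2})`. One row sum has disappeared, so induction on their number concludes.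

The Taylor remainder is evaluated at a noise matrix with one entry multiplied by `t ∈ [0,1]`. This
matrix is again admissible, which is why `Controlled` quantifies over all admissible noise matrices
for a fixed signal. The powers of extracted entries are collected in a separate random weight `ξ`,
and `J` records the used indices. -/

/-! ### Scaled partial derivatives on the space of noise, initialization and signal -/

/-- The space of triples (noise matrix, initialization, signal matrix). -/
abbrev Config (n : ℕ) : Type :=
  (Fin n → Fin n → ℝ) × (Fin n → ℝ) × (Fin n → Fin n → ℝ)

/-- The direction of the noise entry `x_{ii'}` in the space of configurations. -/
def configDir {n : ℕ} (e : Fin n × Fin n) : Config n := (entryDir e, 0, 0)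

/-- The partial derivative with respect to a noise entry, scaled by `√n`. -/
def scaledDeriv {n : ℕ} (e : Fin n × Fin n) (h : Config n → ℝ) (v : Config n) : ℝ :=
  √n * lineDeriv ℝ h v (configDir e)

/-- Iterated scaled partial derivatives. -/
def iterDeriv {n : ℕ} (P : List (Fin n × Fin n)) (h : Config n → ℝ) : Config n → ℝ :=
  P.foldr scaledDeriv h

section Calculus

variable {n : ℕ} {e : Fin n × Fin n} {g h : Config n → ℝ}

lemma iterDeriv_cons (e : Fin n × Fin n) (P : List (Fin n × Fin n)) (h : Config n → ℝ) :
    iterDeriv (e :: P) h = scaledDeriv e (iterDeriv P h) := rfl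

lemma iterDeriv_concat (P : List (Fin n × Fin n)) (e : Fin n × Fin n) (h : Config n → ℝ) :
    iterDeriv (P ++ [e]) h = iterDeriv P (scaledDeriv e h) := by
  simp [iterDeriv]

lemma scaledDeriv_eq_fderiv (hh : ContDiff ℝ ∞ₛ h) (e : Fin n × Fin n) :
    scaledDeriv e h = fun v => √n * fderiv ℝ h v (configDir e) := by
  funext v
  rw [scaledDeriv, ((hh.differentiable (by simp)) v).lineDeriv_eq_fderiv]

lemma contDiff_scaledDeriv (hh : ContDiff ℝ ∞ₛ h) (e : Fin n × Fin n) :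
    ContDiff ℝ ∞ₛ (scaledDeriv e h) := by
  rw [scaledDeriv_eq_fderiv hh]
  exact contDiff_const.mul ((hh.fderiv_right (by simp)).clm_apply contDiff_const)

lemma contDiff_iterDeriv (hh : ContDiff ℝ ∞ₛ h) (P : List (Fin n × Fin n)) :
    ContDiff ℝ ∞ₛ (iterDeriv P h) := by
  induction P with
  | nil => exact hh
  | cons e P ih => exact contDiff_scaledDeriv ih e

lemma scaledDeriv_mul (hg : ContDiff ℝ ∞ₛ g) (hh : ContDiff ℝ ∞ₛ h) (e : Fin n × Fin n) :
    scaledDeriv e (fun v => g v * h v) =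
      fun v => scaledDeriv e g v * h v + g v * scaledDeriv e h v := by
  rw [scaledDeriv_eq_fderiv (hg.mul hh), scaledDeriv_eq_fderiv hg, scaledDeriv_eq_fderiv hh]
  funext v
  rw [fderiv_fun_mul (hg.differentiable (by simp) v) (hh.differentiable (by simp) v)]
  simp only [add_apply, FunLike.coe_smul, Pi.smul_apply, smul_eq_mul]
  ring

lemma scaledDeriv_sum {ι : Type*} (s : Finset ι) {f : ι → Config n → ℝ}
    (hf : ∀ j ∈ s, ContDiff ℝ ∞ₛ (f j)) (e : Fin n × Fin n) :
    scaledDeriv e (fun v => ∑ j ∈ s, f j v) = fun v => ∑ j ∈ s, scaledDeriv e (f j) v := by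
  rw [scaledDeriv_eq_fderiv (ContDiff.sum hf)]
  funext v
  rw [fderiv_fun_sum fun j hj => (hf j hj).differentiable (by simp) v, sum_apply, Finset.mul_sum]
  exact Finset.sum_congr rfl fun j hj => by rw [scaledDeriv_eq_fderiv (hf j hj)]

lemma scaledDeriv_prod {ι : Type*} [DecidableEq ι] (s : Finset ι) {f : ι → Config n → ℝ}
    (hf : ∀ j, ContDiff ℝ ∞ₛ (f j)) (e : Fin n × Fin n) :
    scaledDeriv e (fun v => ∏ j ∈ s, f j v) =
      fun v => ∑ j ∈ s, (∏ l ∈ s.erase j, f l v) * scaledDeriv e (f j) v := by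
  rw [scaledDeriv_eq_fderiv (contDiff_prod fun j _ => hf j)]
  funext v
  rw [fderiv_finsetProd fun j _ => (hf j).differentiable (by simp) v, sum_apply, Finset.mul_sum]
  refine Finset.sum_congr rfl fun j _ => ?_
  rw [scaledDeriv_eq_fderiv (hf j)]
  simp only [FunLike.coe_smul, Pi.smul_apply, smul_eq_mul]
  ring

lemma scaledDeriv_const_mul (c : ℝ) (h : Config n → ℝ) (e : Fin n × Fin n) :
    scaledDeriv e (fun v => c * h v) = fun v => c * scaledDeriv e h v := by
  funext v
  simp only [scaledDeriv, lineDeriv, deriv_const_mul_field']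
  ring

lemma iterDeriv_sum {ι : Type*} (s : Finset ι) {f : ι → Config n → ℝ}
    (hf : ∀ j ∈ s, ContDiff ℝ ∞ₛ (f j)) (P : List (Fin n × Fin n)) :
    iterDeriv P (fun v => ∑ j ∈ s, f j v) = fun v => ∑ j ∈ s, iterDeriv P (f j) v := by
  induction P with
  | nil => rfl
  | cons e P ih =>
    rw [iterDeriv_cons, ih, scaledDeriv_sum s (fun j hj => contDiff_iterDeriv (hf j hj) P)]
    rfl

lemma iterDeriv_add (hg : ContDiff ℝ ∞ₛ g) (hh : ContDiff ℝ ∞ₛ h) (P : List (Fin n × Fin n)) :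
    iterDeriv P (fun v => g v + h v) = fun v => iterDeriv P g v + iterDeriv P h v := by
  have := iterDeriv_sum (Finset.univ : Finset Bool) (f := fun b => cond b g h)
    (by rintro (_ | _) _ <;> assumption) P
  simpa using this

lemma iterDeriv_const_mul (c : ℝ) (h : Config n → ℝ) (P : List (Fin n × Fin n)) :
    iterDeriv P (fun v => c * h v) = fun v => c * iterDeriv P h v := by
  induction P with
  | nil => rfl
  | cons e P ih => rw [iterDeriv_cons, ih, scaledDeriv_const_mul]; rfl

lemma iterDeriv_zero (P : List (Fin n × Fin n)) :
    iterDeriv P (fun _ : Config n => (0 : ℝ)) = fun _ => 0 := by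
  simpa using iterDeriv_const_mul 0 (fun _ : Config n => (0 : ℝ)) P

/-- Functions that do not depend on the noise have vanishing derivatives. -/
lemma scaledDeriv_snd (f : (Fin n → ℝ) × (Fin n → Fin n → ℝ) → ℝ) (e : Fin n × Fin n) :
    scaledDeriv e (fun v : Config n => f v.2) = fun _ => 0 := by
  funext v
  simp [scaledDeriv, lineDeriv, configDir]

lemma scaledDeriv_comp {d : ℕ} {F : (Fin d → ℝ) → ℝ} (hF : ContDiff ℝ ∞ₛ F)
    {f : Fin d → Config n → ℝ} (hf : ∀ j, ContDiff ℝ ∞ₛ (f j)) (e : Fin n × Fin n) :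
    scaledDeriv e (fun v => F fun j => f j v) =
      fun v => ∑ j, fderiv ℝ F (fun j => f j v) (Pi.single j 1) * scaledDeriv e (f j) v := by
  have hfp : ContDiff ℝ ∞ₛ fun v j => f j v := contDiff_pi.2 hf
  rw [scaledDeriv_eq_fderiv (show ContDiff ℝ ∞ₛ fun v => F fun j => f j v from hF.comp hfp)]
  funext v
  have h1 : HasFDerivAt (fun v j => f j v)
      (ContinuousLinearMap.pi fun j => fderiv ℝ (f j) v) v :=
    hasFDerivAt_pi.2 fun j => ((hf j).differentiable (by simp) v).hasFDerivAt
  have h2 := ((hF.differentiable (by simp) (fun j => f j v)).hasFDerivAt).comp v h1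
  change √n * fderiv ℝ (F ∘ fun v j => f j v) v (configDir e) = _
  rw [h2.fderiv]
  simp only [ContinuousLinearMap.coe_comp, Function.comp_apply]
  rw [← LinearMap.sum_single_apply (fun _ : Fin d => ℝ)
    ((ContinuousLinearMap.pi fun j => fderiv ℝ (f j) v) (configDir e)), map_sum, Finset.mul_sum]
  refine Finset.sum_congr rfl fun j _ => ?_
  have h3 : (Pi.single j
      ((ContinuousLinearMap.pi fun j => fderiv ℝ (f j) v) (configDir e) j) : Fin d → ℝ) =
      (fderiv ℝ (f j) v (configDir e)) • (Pi.single j 1 : Fin d → ℝ) := by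
    rw [← Pi.single_smul]; simp
  rw [h3, map_smul, scaledDeriv_eq_fderiv (hf j), smul_eq_mul]
  ring

/-- The partial derivatives of a function with bounded derivatives have bounded derivatives. -/
lemma SmoothBddDeriv.fderiv_apply {d : ℕ} {F : (Fin d → ℝ) → ℝ} (hF : SmoothBddDeriv F)
    (c : Fin d → ℝ) : SmoothBddDeriv fun x => fderiv ℝ F x c := by
  have h1 : ContDiff ℝ ∞ₛ (fderiv ℝ F) := hF.1.fderiv_right (by simp)
  refine ⟨h1.clm_apply contDiff_const, fun j _ => ?_⟩
  obtain ⟨B, hB⟩ := hF.2 (j + 1) (by omega)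
  refine ⟨‖c‖ * B, fun x => ?_⟩
  refine (norm_iteratedFDeriv_clm_apply_const (h1.contDiffAt (x := x)) (n := j)
    (by exact_mod_cast le_top)).trans ?_
  rw [norm_iteratedFDeriv_fderiv]
  gcongr
  exact hB x

/-- Functions with bounded first derivative grow at most linearly. -/
lemma SmoothBddDeriv.exists_linear_growth {d : ℕ} {F : (Fin d → ℝ) → ℝ} (hF : SmoothBddDeriv F) :
    ∃ L : ℝ≥0, ∀ x, |F x| ≤ |F 0| + L * ∑ j, |x j| := by
  obtain ⟨B, hB⟩ := hF.2 1 le_rfl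
  refine ⟨B.toNNReal, fun x => ?_⟩
  have h1 : ∀ x, ‖fderiv ℝ F x‖ ≤ B.toNNReal := fun x => by
    rw [← norm_iteratedFDeriv_one]; exact (hB x).trans (Real.le_coe_toNNReal B)
  have h2 := Convex.norm_image_sub_le_of_norm_fderiv_le (𝕜 := ℝ) (f := F) (s := Set.univ)
    (fun y _ => hF.1.differentiable (by simp) y) (fun y _ => h1 y) convex_univ
    (Set.mem_univ 0) (Set.mem_univ x)
  have h3 : ‖x - 0‖ ≤ ∑ j, |x j| := by
    rw [sub_zero]
    refine (pi_norm_le_iff_of_nonneg (Finset.sum_nonneg fun _ _ => abs_nonneg _)).2 fun j => ?_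
    exact Finset.single_le_sum (f := fun j => |x j|) (fun _ _ => abs_nonneg _) (Finset.mem_univ j)
  have h4 : |F x| ≤ |F 0| + |F x - F 0| := by
    have := abs_add_le (F 0) (F x - F 0); simpa using this
  refine h4.trans ?_
  gcongr
  exact h2.trans (by gcongr)

/-- Iterated partial derivatives in the noise entries are scaled derivatives on configurations. -/
lemma iterDeriv_eq_partialDeriv (P : List (Fin n × Fin n)) (h : Config n → ℝ)
    (X : Matrix (Fin n) (Fin n) ℝ) (u : Fin n → ℝ) (Z : Matrix (Fin n) (Fin n) ℝ) :
    iterDeriv P h (X, u, Z) = √n ^ P.length * partialDeriv P (fun X => h (X, u, Z)) X := by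
  induction P generalizing X with
  | nil => simp [partialDeriv, iterDeriv]
  | cons e P ih =>
    rw [iterDeriv_cons, scaledDeriv, partialDeriv, List.length_cons, pow_succ', mul_assoc]
    congr 1
    simp only [lineDeriv]
    rw [← deriv_const_mul_field]
    congr 1
    funext t
    rw [← ih]
    congr 1
    have hu : u + t • 0 = u := by simp
    have hZ : (Z : Fin n → Fin n → ℝ) + t • 0 = Z := by simp
    exact Prod.ext rfl (Prod.ext hu hZ)

end Calculus

/-! ### Normalized row sums of the noise -/

/-- The normalized `i`-th row sum `n^{-1/2} ∑ j, x_{ij} w_j`. -/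
def rowSum {n : ℕ} (i : Fin n) (w : Fin n → Config n → ℝ) (v : Config n) : ℝ :=
  (√n)⁻¹ * ∑ j, v.1 i j * w j v

section RowSum

variable {n : ℕ} {w : Fin n → Config n → ℝ}

lemma contDiff_noise (i j : Fin n) : ContDiff ℝ ∞ₛ fun v : Config n => v.1 i j := by fun_prop

lemma contDiff_rowSum (i : Fin n) (hw : ∀ j, ContDiff ℝ ∞ₛ (w j)) : ContDiff ℝ ∞ₛ (rowSum i w) :=
  contDiff_const.mul (ContDiff.sum fun j _ => (contDiff_noise i j).mul (hw j))

lemma scaledDeriv_noise (i j : Fin n) (e : Fin n × Fin n) :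
    scaledDeriv e (fun v : Config n => v.1 i j) = fun _ => √n * entryDir e i j := by
  have h : (fun v : Config n => v.1 i j) =
    (ContinuousLinearMap.proj (R := ℝ) (φ := fun _ : Fin n => ℝ) j ∘L
      ContinuousLinearMap.proj (R := ℝ) (φ := fun _ : Fin n => Fin n → ℝ) i ∘L
        ContinuousLinearMap.fst ℝ _ _ : Config n →L[ℝ] ℝ) := rfl
  rw [scaledDeriv_eq_fderiv (contDiff_noise i j)]
  funext v
  rw [h, ContinuousLinearMap.fderiv]
  rfl

/-- The `√n` of the scaled derivative cancels the normalization of the row sum, so differentiating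
the entry itself releases a weight with no power of `n` left over. Both positions of the symmetric
entry move, hence the two indicator terms. -/
lemma scaledDeriv_rowSum (hn : 0 < n) (i : Fin n) (hw : ∀ j, ContDiff ℝ ∞ₛ (w j))
    (e : Fin n × Fin n) :
    scaledDeriv e (rowSum i w) = fun v => rowSum i (fun j => scaledDeriv e (w j)) v +
      ((if i = e.1 then w e.2 v else 0) + if i = e.2 then w e.1 v else 0) := by
  have hs : √(n : ℝ) ≠ 0 := by positivity
  unfold rowSum
  rw [scaledDeriv_const_mul,
    scaledDeriv_sum Finset.univ fun j _ => (contDiff_noise i j).mul (hw j)]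
  funext v
  simp_rw [fun j => scaledDeriv_mul (contDiff_noise i j) (hw j) e, scaledDeriv_noise]
  rw [Finset.sum_add_distrib, mul_add, add_comm]
  congr 1
  simp_rw [mul_assoc]
  rw [← Finset.mul_sum, ← mul_assoc, inv_mul_cancel₀ hs, one_mul]
  simp only [entryDir, Matrix.add_apply, Matrix.single_apply, add_mul, Finset.sum_add_distrib]
  congr 1
  · by_cases h : i = e.1 <;> simp [h, eq_comm]
  · by_cases h : i = e.2 <;> simp [h, eq_comm]

end RowSum

/-! ### Models and functions of the configuration with controlled derivatives -/

/-- A signal satisfying the moment assumptions, on some probability space and in some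
dimension. -/
structure Model (σ C : ℝ) : Type (u + 1) where
  n : ℕ
  pos : 0 < n
  Ω : Type u
  mΩ : MeasurableSpace Ω
  μ : Measure Ω
  prob : IsProbabilityMeasure μ
  u0 : Ω → Fin n → ℝ
  Z : Ω → Matrix (Fin n) (Fin n) ℝ
  signal : IsSignal μ σ C u0 Z

attribute [instance] Model.mΩ Model.prob

namespace Model

variable {𝔐 : Model.{u} σ C}

variable (𝔐) in
/-- The admissible noise matrices of a model. -/
def Noise (A : 𝔐.Ω → Matrix (Fin 𝔐.n) (Fin 𝔐.n) ℝ) : Prop := IsNoise 𝔐.μ σ 𝔐.u0 𝔐.Z A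

variable (𝔐) in
/-- The random configuration. -/
def config (A : 𝔐.Ω → Matrix (Fin 𝔐.n) (Fin 𝔐.n) ℝ) (ω : 𝔐.Ω) : Config 𝔐.n :=
  (A ω, 𝔐.u0 ω, 𝔐.Z ω)

lemma Noise.measurable_config {A : 𝔐.Ω → Matrix (Fin 𝔐.n) (Fin 𝔐.n) ℝ} (hA : 𝔐.Noise A) :
    Measurable (𝔐.config A) := by
  refine Measurable.prodMk ?_ (Measurable.prodMk ?_ ?_)
  · exact measurable_pi_lambda _ fun i => measurable_pi_lambda _ fun j => hA.measurable i j
  · exact measurable_pi_lambda _ fun i => 𝔐.signal.measurable_init i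
  · exact measurable_pi_lambda _ fun i => measurable_pi_lambda _ fun j =>
      𝔐.signal.measurable_signal i j

lemma Noise.measurable_comp {A : 𝔐.Ω → Matrix (Fin 𝔐.n) (Fin 𝔐.n) ℝ} (hA : 𝔐.Noise A)
    {h : Config 𝔐.n → ℝ} (hh : ContDiff ℝ ∞ₛ h) : Measurable fun ω => h (𝔐.config A ω) :=
  hh.continuous.measurable.comp hA.measurable_config

lemma Noise.aestronglyMeasurable_comp {A : 𝔐.Ω → Matrix (Fin 𝔐.n) (Fin 𝔐.n) ℝ}
    (hA : 𝔐.Noise A) {h : Config 𝔐.n → ℝ} (hh : ContDiff ℝ ∞ₛ h) :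
    AEStronglyMeasurable (fun ω => h (𝔐.config A ω)) 𝔐.μ :=
  (hA.measurable_comp hh).aestronglyMeasurable

variable (𝔐) in
/-- The scaled derivatives of `h` up to order `M` have moments bounded by `B`, uniformly over the
admissible noise matrices. -/
structure Controlled (M : ℕ) (B : ℕ → ℕ → ℝ≥0) (h : Config 𝔐.n → ℝ) : Prop where
  smooth : ContDiff ℝ ∞ₛ h
  bound : ∀ A, 𝔐.Noise A → ∀ P : List (Fin 𝔐.n × Fin 𝔐.n), (∀ e ∈ P, e.1 < e.2) →
    P.length ≤ M → ∀ p : ℕ, 1 ≤ p →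
      eLpNorm (fun ω => iterDeriv P h (𝔐.config A ω)) p 𝔐.μ ≤ B p P.length

variable (𝔐) in
/-- The scaled derivatives of `h` of all orders have moments bounded by `B`. -/
def Tame (B : ℕ → ℕ → ℝ≥0) (h : Config 𝔐.n → ℝ) : Prop := ∀ M, 𝔐.Controlled M B h

variable {M : ℕ} {B B' : ℕ → ℕ → ℝ≥0} {g h : Config 𝔐.n → ℝ}

lemma Controlled.eLpNorm_le (hh : 𝔐.Controlled M B h)
    {A : 𝔐.Ω → Matrix (Fin 𝔐.n) (Fin 𝔐.n) ℝ} (hA : 𝔐.Noise A) {p : ℕ} (hp : 1 ≤ p) :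
    eLpNorm (fun ω => h (𝔐.config A ω)) p 𝔐.μ ≤ B p 0 :=
  hh.bound A hA [] (by simp) (by simp) p hp

lemma Controlled.mono (hh : 𝔐.Controlled M B h) (hB : ∀ p m, B p m ≤ B' p m) :
    𝔐.Controlled M B' h :=
  ⟨hh.smooth, fun A hA P hP hM p hp =>
    (hh.bound A hA P hP hM p hp).trans (by exact_mod_cast hB _ _)⟩

lemma Controlled.of_le {M' : ℕ} (hh : 𝔐.Controlled M B h) (hM : M' ≤ M) : 𝔐.Controlled M' B h :=
  ⟨hh.smooth, fun A hA P hP hP' => hh.bound A hA P hP (hP'.trans hM)⟩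

/-- The extra derivative is appended at the end of the list, which is the innermost one and acts on
`h` first. -/
lemma Controlled.scaledDeriv (hh : 𝔐.Controlled (M + 1) B h) {e : Fin 𝔐.n × Fin 𝔐.n}
    (he : e.1 < e.2) : 𝔐.Controlled M (fun p m => B p (m + 1)) (scaledDeriv e h) := by
  refine ⟨contDiff_scaledDeriv hh.smooth e, fun A hA P hP hM p hp => ?_⟩
  have := hh.bound A hA (P ++ [e]) (by
    intro e' he'
    rcases List.mem_append.1 he' with h' | h'
    · exact hP e' h'
    · rwa [List.mem_singleton.1 h'])
    (by simpa using hM) p hp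
  rw [iterDeriv_concat] at this
  simpa using this

/-- The induction principle for all closure properties: peel off the innermost derivative, so that
only the moments of `h` itself and a formula for its first derivative are needed. -/
lemma Controlled.of_scaledDeriv (hs : ContDiff ℝ ∞ₛ h)
    (h0 : ∀ A, 𝔐.Noise A → ∀ p : ℕ, 1 ≤ p →
      eLpNorm (fun ω => h (𝔐.config A ω)) p 𝔐.μ ≤ B p 0)
    (h1 : ∀ e : Fin 𝔐.n × Fin 𝔐.n, e.1 < e.2 →
      𝔐.Controlled M (fun p m => B p (m + 1)) (AMP.scaledDeriv e h)) :
    𝔐.Controlled (M + 1) B h := by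
  refine ⟨hs, fun A hA P hP hM p hp => ?_⟩
  rcases List.eq_nil_or_concat P with rfl | ⟨L, e, rfl⟩
  · exact h0 A hA p hp
  · rw [List.concat_eq_append] at *
    rw [iterDeriv_concat, List.length_append]
    exact (h1 e (hP e (by simp))).bound A hA L (fun e' he' => hP e' (by simp [he']))
      (by simpa using hM) p hp

lemma controlled_zero (hs : ContDiff ℝ ∞ₛ h)
    (h0 : ∀ A, 𝔐.Noise A → ∀ p : ℕ, 1 ≤ p →
      eLpNorm (fun ω => h (𝔐.config A ω)) p 𝔐.μ ≤ B p 0) : 𝔐.Controlled 0 B h := by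
  refine ⟨hs, fun A hA P hP hM p hp => ?_⟩
  obtain rfl : P = [] := List.length_eq_zero_iff.1 (by omega)
  exact h0 A hA p hp

/-- Induction on `M` gives bounds that may change with `M`. A list of length `m` is already covered
by the case `M = m`, so the diagonal choice serves all orders at once. -/
lemma tame_of_forall {B : ℕ → ℕ → ℕ → ℝ≥0} (hh : ∀ M, 𝔐.Controlled M (B M) h) :
    𝔐.Tame (fun p m => B m p m) h := fun _ =>
  ⟨(hh 0).smooth, fun A hA P hP _ p hp => (hh P.length).bound A hA P hP le_rfl p hp⟩

lemma Tame.smooth (hh : 𝔐.Tame B h) : ContDiff ℝ ∞ₛ h := (hh 0).smooth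

lemma Tame.mono (hh : 𝔐.Tame B h) (hB : ∀ p m, B p m ≤ B' p m) : 𝔐.Tame B' h :=
  fun M => (hh M).mono hB

lemma Tame.scaledDeriv (hh : 𝔐.Tame B h) {e : Fin 𝔐.n × Fin 𝔐.n} (he : e.1 < e.2) :
    𝔐.Tame (fun p m => B p (m + 1)) (scaledDeriv e h) :=
  fun M => (hh (M + 1)).scaledDeriv he

lemma Tame.iterDeriv (hh : 𝔐.Tame B h) {P : List (Fin 𝔐.n × Fin 𝔐.n)}
    (hP : ∀ e ∈ P, e.1 < e.2) :
    𝔐.Tame (fun p m => B p (m + P.length)) (iterDeriv P h) := by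
  induction P with
  | nil => exact hh
  | cons e P ih =>
    have := (ih fun e' he' => hP e' (by simp [he'])).scaledDeriv (hP e (by simp))
    refine this.mono fun p m => ?_
    rw [List.length_cons, show m + 1 + P.length = m + (P.length + 1) by omega]

lemma Controlled.sum {ι : Type*} {s : Finset ι} {f : ι → Config 𝔐.n → ℝ}
    (hf : ∀ j ∈ s, 𝔐.Controlled M B (f j)) :
    𝔐.Controlled M (fun p m => s.card * B p m) (fun v => ∑ j ∈ s, f j v) := by
  refine ⟨ContDiff.sum fun j hj => (hf j hj).smooth, fun A hA P hP hM p hp => ?_⟩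
  rw [iterDeriv_sum s fun j hj => (hf j hj).smooth]
  have h1 := eLpNorm_sum_le (μ := 𝔐.μ) (p := p) (s := s)
    (f := fun j ω => AMP.iterDeriv P (f j) (𝔐.config A ω))
    (fun j hj => hA.aestronglyMeasurable_comp (contDiff_iterDeriv (hf j hj).smooth P))
    (by exact_mod_cast hp)
  have h2 : (∑ j ∈ s, fun ω => AMP.iterDeriv P (f j) (𝔐.config A ω)) =
      fun ω => ∑ j ∈ s, AMP.iterDeriv P (f j) (𝔐.config A ω) := by ext; simp
  rw [h2] at h1
  refine h1.trans ((Finset.sum_le_sum fun j hj => (hf j hj).bound A hA P hP hM p hp).trans ?_)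
  simp

lemma Controlled.add (hg : 𝔐.Controlled M B g) (hh : 𝔐.Controlled M B' h) :
    𝔐.Controlled M (fun p m => B p m + B' p m) (fun v => g v + h v) := by
  refine ⟨hg.smooth.add hh.smooth, fun A hA P hP hM p hp => ?_⟩
  rw [iterDeriv_add hg.smooth hh.smooth]
  refine (eLpNorm_add_le (hA.aestronglyMeasurable_comp (contDiff_iterDeriv hg.smooth P))
    (hA.aestronglyMeasurable_comp (contDiff_iterDeriv hh.smooth P))
    (by exact_mod_cast hp)).trans ?_
  push_cast
  exact add_le_add (hg.bound A hA P hP hM p hp) (hh.bound A hA P hP hM p hp)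

lemma Controlled.const_mul (hh : 𝔐.Controlled M B h) (c : ℝ) :
    𝔐.Controlled M (fun p m => ‖c‖₊ * B p m) (fun v => c * h v) := by
  refine ⟨contDiff_const.mul hh.smooth, fun A hA P hP hM p hp => ?_⟩
  rw [iterDeriv_const_mul]
  refine (eLpNorm_const_smul_le (c := c)
    (f := fun ω => AMP.iterDeriv P h (𝔐.config A ω))).trans ?_
  push_cast
  exact mul_le_mul_right (hh.bound A hA P hP hM p hp) _

lemma Tame.add (hg : 𝔐.Tame B g) (hh : 𝔐.Tame B' h) :
    𝔐.Tame (fun p m => B p m + B' p m) (fun v => g v + h v) := fun M => (hg M).add (hh M)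

lemma controlled_zero_fun : 𝔐.Controlled M B (fun _ => 0) := by
  refine ⟨contDiff_const, fun A hA P hP hM p hp => ?_⟩
  rw [iterDeriv_zero]
  simp

/-- The empirical mean of controlled functions. -/
lemma Tame.mean {f : Fin 𝔐.n → Config 𝔐.n → ℝ} (hf : ∀ j, 𝔐.Tame B (f j)) :
    𝔐.Tame B (fun v => (𝔐.n : ℝ)⁻¹ * ∑ j, f j v) := by
  intro M
  refine ((Controlled.sum (s := Finset.univ) fun j _ => hf j M).const_mul _).mono fun p m => ?_
  have : (𝔐.n : ℝ≥0) ≠ 0 := by exact_mod_cast 𝔐.pos.ne'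
  simp [this]

end Model

/-! ### Closure under products and smooth composition -/

lemma eLpNorm_mul_le_two {Ω : Type*} [MeasurableSpace Ω] {μ : Measure Ω} {f g : Ω → ℝ}
    (hf : AEStronglyMeasurable f μ) (hg : AEStronglyMeasurable g μ) (p : ℕ) :
    eLpNorm (fun ω => f ω * g ω) p μ ≤
      eLpNorm f ((2 * p : ℕ) : ℝ≥0∞) μ * eLpNorm g ((2 * p : ℕ) : ℝ≥0∞) μ := by
  have : ENNReal.HolderTriple ((2 * p : ℕ) : ℝ≥0∞) ((2 * p : ℕ) : ℝ≥0∞) p := by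
    constructor
    push_cast
    rw [ENNReal.mul_inv (by simp) (by simp), ← add_mul, ENNReal.inv_two_add_inv_two, one_mul]
  exact eLpNorm_smul_le_mul_eLpNorm (p := ((2 * p : ℕ) : ℝ≥0∞)) (q := ((2 * p : ℕ) : ℝ≥0∞))
    (r := (p : ℝ≥0∞)) (φ := f) (f := g) hg hf

namespace Model

/-- Leibniz reduces order `M + 1` to two products of order `M`, and Hölder with exponents `2p`, `2p`
gives order zero. The new bound is fixed before the model, which makes it independent of `n`. -/
lemma exists_controlled_mul (M : ℕ) (B B' : ℕ → ℕ → ℝ≥0) :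
    ∃ B'' : ℕ → ℕ → ℝ≥0, ∀ (𝔐 : Model.{u} σ C) (g h : Config 𝔐.n → ℝ),
      𝔐.Controlled M B g → 𝔐.Controlled M B' h → 𝔐.Controlled M B'' (fun v => g v * h v) := by
  have key : ∀ {M} (B B' : ℕ → ℕ → ℝ≥0) (𝔐 : Model.{u} σ C) (g h : Config 𝔐.n → ℝ),
      𝔐.Controlled M B g → 𝔐.Controlled M B' h → ∀ A, 𝔐.Noise A → ∀ p : ℕ, 1 ≤ p →
      eLpNorm (fun ω => g (𝔐.config A ω) * h (𝔐.config A ω)) p 𝔐.μ ≤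
        ((B (2 * p) 0 * B' (2 * p) 0 : ℝ≥0) : ℝ≥0∞) := by
    intro M B B' 𝔐 g h hg hh A hA p hp
    refine (eLpNorm_mul_le_two (hA.aestronglyMeasurable_comp hg.smooth)
      (hA.aestronglyMeasurable_comp hh.smooth) p).trans ?_
    rw [ENNReal.coe_mul]
    exact mul_le_mul' (hg.eLpNorm_le hA (by omega)) (hh.eLpNorm_le hA (by omega))
  induction M generalizing B B' with
  | zero =>
    refine ⟨fun p _ => B (2 * p) 0 * B' (2 * p) 0, fun 𝔐 g h hg hh => ?_⟩
    exact controlled_zero (hg.smooth.mul hh.smooth) (key B B' 𝔐 g h hg hh)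
  | succ M ih =>
    obtain ⟨B₁, h₁⟩ := ih (fun p m => B p (m + 1)) B'
    obtain ⟨B₂, h₂⟩ := ih B (fun p m => B' p (m + 1))
    -- Order zero takes the Hölder bound; order `m + 1` takes the bound at order `m` for the two
    -- Leibniz terms.
    refine ⟨fun p m => m.casesOn (B (2 * p) 0 * B' (2 * p) 0) (fun m => B₁ p m + B₂ p m),
      fun 𝔐 g h hg hh => Controlled.of_scaledDeriv (hg.smooth.mul hh.smooth)
        (key B B' 𝔐 g h hg hh) fun e he => ?_⟩
    rw [scaledDeriv_mul hg.smooth hh.smooth]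
    exact (h₁ 𝔐 _ _ (hg.scaledDeriv he) (hh.of_le (by omega))).add
      (h₂ 𝔐 _ _ (hg.of_le (by omega)) (hh.scaledDeriv he))

lemma exists_tame_mul (B B' : ℕ → ℕ → ℝ≥0) :
    ∃ B'' : ℕ → ℕ → ℝ≥0, ∀ (𝔐 : Model.{u} σ C) (g h : Config 𝔐.n → ℝ),
      𝔐.Tame B g → 𝔐.Tame B' h → 𝔐.Tame B'' (fun v => g v * h v) := by
  choose B'' hB using fun M => exists_controlled_mul.{u} (σ := σ) (C := C) M B B'
  exact ⟨_, fun 𝔐 g h hg hh => tame_of_forall fun M => hB M 𝔐 g h (hg M) (hh M)⟩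

/-- The moments of `F ∘ f` follow from linear growth. A derivative is a sum of products of `∂_jF ∘
f` with derivatives of `f_j`, and `∂_jF` is again of the same class as `F`; hence the induction on
`M` runs over all `F` simultaneously. -/
lemma exists_controlled_comp (M : ℕ) {d : ℕ} {F : (Fin d → ℝ) → ℝ} (hF : SmoothBddDeriv F)
    (B : ℕ → ℕ → ℝ≥0) :
    ∃ B' : ℕ → ℕ → ℝ≥0, ∀ (𝔐 : Model.{u} σ C) (f : Fin d → Config 𝔐.n → ℝ),
      (∀ j, 𝔐.Controlled M B (f j)) → 𝔐.Controlled M B' (fun v => F fun j => f j v) := by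
  have key : ∀ {F : (Fin d → ℝ) → ℝ} (_ : SmoothBddDeriv F), ∃ K : ℕ → ℝ≥0, ∀ {M}
      (𝔐 : Model.{u} σ C) (f : Fin d → Config 𝔐.n → ℝ),
      (∀ j, 𝔐.Controlled M B (f j)) → ∀ A, 𝔐.Noise A → ∀ p : ℕ, 1 ≤ p →
      eLpNorm (fun ω => F fun j => f j (𝔐.config A ω)) p 𝔐.μ ≤ K p := by
    intro F hF
    obtain ⟨L, hL⟩ := hF.exists_linear_growth
    refine ⟨fun p => ‖F 0‖₊ + L * ∑ _j : Fin d, B p 0, fun {M} 𝔐 f hf A hA p hp => ?_⟩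
    have hp' : (1 : ℝ≥0∞) ≤ p := by exact_mod_cast hp
    have hm : ∀ j, AEStronglyMeasurable (fun ω => |f j (𝔐.config A ω)|) 𝔐.μ := fun j =>
      (hA.aestronglyMeasurable_comp (hf j).smooth).norm
    have hs : AEStronglyMeasurable (fun ω => ∑ j, |f j (𝔐.config A ω)|) 𝔐.μ :=
      Finset.aestronglyMeasurable_fun_sum _ fun j _ => hm j
    have h1 : eLpNorm (fun ω => F fun j => f j (𝔐.config A ω)) p 𝔐.μ ≤
        eLpNorm (fun ω => |F 0| + L * ∑ j, |f j (𝔐.config A ω)|) p 𝔐.μ :=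
      eLpNorm_mono_real fun ω => hL _
    have h2 := eLpNorm_add_le (p := p) (μ := 𝔐.μ) (f := fun _ => |F 0|)
      (g := fun ω => (L : ℝ) * ∑ j, |f j (𝔐.config A ω)|) aestronglyMeasurable_const
      (hs.const_mul _) hp'
    have h3 : eLpNorm (fun _ : 𝔐.Ω => |F 0|) p 𝔐.μ ≤ ‖F 0‖₊ := by
      rw [eLpNorm_const _ (by positivity) (IsProbabilityMeasure.ne_zero 𝔐.μ)]
      simp [Real.enorm_abs]
    have h4 : eLpNorm (fun ω => (L : ℝ) * ∑ j, |f j (𝔐.config A ω)|) p 𝔐.μ ≤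
        L * ∑ _j : Fin d, B p 0 := by
      refine (eLpNorm_const_smul_le (c := (L : ℝ))
        (f := fun ω => ∑ j, |f j (𝔐.config A ω)|)).trans ?_
      refine mul_le_mul' (by simp) ?_
      have h5 := eLpNorm_sum_le (μ := 𝔐.μ) (p := p) (s := Finset.univ)
        (f := fun j ω => |f j (𝔐.config A ω)|) (fun j _ => hm j) hp'
      have h6 : (∑ j, fun ω => |f j (𝔐.config A ω)|) =
        fun ω => ∑ j, |f j (𝔐.config A ω)| := by ext; simp
      rw [h6] at h5
      push_cast
      refine h5.trans (Finset.sum_le_sum fun j _ => ?_)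
      refine (eLpNorm_norm (fun ω => f j (𝔐.config A ω))).le.trans ((hf j).eLpNorm_le hA hp)
    refine h1.trans (h2.trans ?_)
    push_cast at h4 ⊢
    exact add_le_add h3 h4
  induction M generalizing F with
  | zero =>
    obtain ⟨K, hK⟩ := key hF
    exact ⟨fun p _ => K p, fun 𝔐 f hf => controlled_zero
      (hF.1.comp (contDiff_pi.2 fun j => (hf j).smooth)) (hK 𝔐 f hf)⟩
  | succ M ih =>
    obtain ⟨K, hK⟩ := key hF
    choose B₁ h₁ using fun j : Fin d => ih (hF.fderiv_apply (Pi.single j 1))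
    choose B₂ h₂ using fun j : Fin d =>
      exists_controlled_mul.{u} (σ := σ) (C := C) M (B₁ j) fun p m => B p (m + 1)
    refine ⟨fun p m => m.casesOn (K p) (fun m => (Finset.univ : Finset (Fin d)).card *
      ∑ j, B₂ j p m), fun 𝔐 f hf =>
      Controlled.of_scaledDeriv (hF.1.comp (contDiff_pi.2 fun j => (hf j).smooth))
        (hK 𝔐 f hf) fun e he => ?_⟩
    rw [scaledDeriv_comp hF.1 fun j => (hf j).smooth]
    refine Controlled.sum fun j _ => (h₂ j 𝔐 _ _ (h₁ j 𝔐 f fun j => (hf j).of_le (by omega))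
      ((hf j).scaledDeriv he)).mono fun p m => ?_
    exact Finset.single_le_sum (f := fun j => B₂ j p m) (fun _ _ => zero_le) (Finset.mem_univ j)

lemma exists_tame_comp {d : ℕ} {F : (Fin d → ℝ) → ℝ} (hF : SmoothBddDeriv F)
    (B : ℕ → ℕ → ℝ≥0) :
    ∃ B' : ℕ → ℕ → ℝ≥0, ∀ (𝔐 : Model.{u} σ C) (f : Fin d → Config 𝔐.n → ℝ),
      (∀ j, 𝔐.Tame B (f j)) → 𝔐.Tame B' (fun v => F fun j => f j v) := by
  choose B' hB using fun M => exists_controlled_comp.{u} (σ := σ) (C := C) M hF B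
  exact ⟨_, fun 𝔐 f hf => tame_of_forall fun M => hB M 𝔐 f fun j => hf j M⟩

end Model

/-! ### Moments of the entries -/

lemma eLpNorm_le_of_pow_le {Ω : Type*} [MeasurableSpace Ω] {μ : Measure Ω} {f G : Ω → ℝ} {p : ℕ}
    (hp : 1 ≤ p) (hG : Integrable G μ) (hfG : ∀ ω, |f ω| ^ p ≤ G ω) {K : ℝ}
    (hK : ∫ ω, G ω ∂μ ≤ K) :
    eLpNorm f p μ ≤ ((K.toNNReal ^ (1 / (p : ℝ)) : ℝ≥0) : ℝ≥0∞) := by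
  have hp0 : (p : ℝ≥0∞) ≠ 0 := by exact_mod_cast (by omega : p ≠ 0)
  rw [eLpNorm_eq_lintegral_rpow_enorm_toReal hp0 (by simp), ENNReal.toReal_natCast,
    ENNReal.coe_rpow_of_nonneg _ (by positivity)]
  gcongr
  have hG0 : ∀ ω, 0 ≤ G ω := fun ω => le_trans (by positivity) (hfG ω)
  calc ∫⁻ ω, ‖f ω‖ₑ ^ (p : ℝ) ∂μ ≤ ∫⁻ ω, ENNReal.ofReal (G ω) ∂μ := by
        refine lintegral_mono fun ω => ?_
        rw [ENNReal.rpow_natCast, Real.enorm_eq_ofReal_abs, ← ENNReal.ofReal_pow (abs_nonneg _)]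
        exact ENNReal.ofReal_le_ofReal (hfG ω)
    _ = ENNReal.ofReal (∫ ω, G ω ∂μ) :=
        (ofReal_integral_eq_lintegral_ofReal hG (Filter.Eventually.of_forall hG0)).symm
    _ ≤ ENNReal.ofReal K := ENNReal.ofReal_le_ofReal hK

lemma pow_abs_le_exp {s : ℝ} (hs : 0 < s) (x : ℝ) (p : ℕ) :
    |x| ^ p ≤ s ^ p * p.factorial * Real.exp (|x| / s) := by
  have h := Real.pow_div_factorial_le_exp (|x| / s) (by positivity) p
  rw [div_pow, div_div, div_le_iff₀ (by positivity)] at h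
  linarith

/-- Bound for the moments of a variable with an exponential moment. -/
def expMomentBound (s C : ℝ) (p : ℕ) : ℝ≥0 :=
  (s ^ p * p.factorial * C).toNNReal ^ (1 / (p : ℝ))

lemma eLpNorm_le_expMomentBound {Ω : Type*} [MeasurableSpace Ω] {μ : Measure Ω} {f : Ω → ℝ}
    {s C : ℝ} (hs : 0 < s) (hi : Integrable (fun ω => Real.exp (|f ω| / s)) μ)
    (hC : ∫ ω, Real.exp (|f ω| / s) ∂μ ≤ C) {p : ℕ} (hp : 1 ≤ p) :
    eLpNorm f p μ ≤ expMomentBound s C p := by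
  refine eLpNorm_le_of_pow_le hp (hi.const_mul (s ^ p * p.factorial))
    (fun ω => pow_abs_le_exp hs _ _) ?_
  rw [integral_const_mul]
  gcongr

namespace Model

variable {𝔐 : Model.{u} σ C} {A : 𝔐.Ω → Matrix (Fin 𝔐.n) (Fin 𝔐.n) ℝ}

/-- From `e^{|x|} ≤ e^x + e^{-x}` and the subgaussian bound at `λ = ±1`, the exponential moment is
at most `2 e^{σ²/2}`, whatever the variance proxy `σ' ≤ σ` of the entry. -/
lemma Noise.eLpNorm_entry_le (hA : 𝔐.Noise A) (i j : Fin 𝔐.n) {p : ℕ}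
    (hp : 1 ≤ p) :
    eLpNorm (fun ω => A ω i j) p 𝔐.μ ≤ expMomentBound 1 (2 * Real.exp (σ ^ 2 / 2)) p := by
  obtain ⟨s, hs, hsub⟩ := hA.subgaussian i j
  have hs2 : (s : ℝ) ^ 2 ≤ σ ^ 2 := by gcongr
  have h1 : Integrable (fun ω => Real.exp (1 * A ω i j) + Real.exp (-1 * A ω i j)) 𝔐.μ :=
    (hsub.integrable_exp_mul 1).add (hsub.integrable_exp_mul (-1))
  have hle : ∀ ω, Real.exp (|A ω i j| / 1) ≤
      Real.exp (1 * A ω i j) + Real.exp (-1 * A ω i j) := fun ω => by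
    rcases abs_choice (A ω i j) with h | h <;> rw [h] <;> simp [Real.exp_pos, le_of_lt]
  have hi : Integrable (fun ω => Real.exp (|A ω i j| / 1)) 𝔐.μ := by
    refine h1.mono' ?_ (Filter.Eventually.of_forall fun ω => ?_)
    · have := hA.measurable i j
      exact (by fun_prop : Measurable _).aestronglyMeasurable
    · rw [Real.norm_of_nonneg (Real.exp_pos _).le]; exact hle ω
  refine eLpNorm_le_expMomentBound one_pos hi ?_ hp
  refine (integral_mono hi h1 hle).trans ?_
  rw [integral_add (hsub.integrable_exp_mul 1) (hsub.integrable_exp_mul (-1))]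
  have h2 := hsub.mgf_le 1
  have h3 := hsub.mgf_le (-1)
  simp only [mgf] at h2 h3
  have h4 : Real.exp (((s ^ 2 : ℝ≥0) : ℝ) / 2) ≤ Real.exp (σ ^ 2 / 2) := by
    push_cast; gcongr
  norm_num at h2 h3 ⊢
  push_cast at h4
  linarith

variable (𝔐) in
lemma tame_of_snd {f : (Fin 𝔐.n → ℝ) × (Fin 𝔐.n → Fin 𝔐.n → ℝ) → ℝ}
    (hf : ContDiff ℝ ∞ₛ f) {B : ℕ → ℝ≥0}
    (hB : ∀ p : ℕ, 1 ≤ p → eLpNorm (fun ω => f (𝔐.u0 ω, 𝔐.Z ω)) p 𝔐.μ ≤ B p) :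
    𝔐.Tame (fun p _ => B p) (fun v => f v.2) := by
  intro M
  have hs : ContDiff ℝ ∞ₛ fun v : Config 𝔐.n => f v.2 := hf.comp contDiff_snd
  cases M with
  | zero => exact controlled_zero hs fun A _ p hp => hB p hp
  | succ M =>
    refine Controlled.of_scaledDeriv hs (fun A _ p hp => hB p hp) fun e _ => ?_
    rw [scaledDeriv_snd]
    exact controlled_zero_fun

variable (𝔐) in
lemma tame_init (hσ : 0 < σ) (i : Fin 𝔐.n) :
    𝔐.Tame (fun p _ => expMomentBound σ C p) (fun v => v.2.1 i) :=
  𝔐.tame_of_snd (f := fun x => x.1 i) (by fun_prop) fun _ hp =>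
    eLpNorm_le_expMomentBound hσ (𝔐.signal.init_integrable i) (𝔐.signal.init_le i) hp

variable (𝔐) in
lemma tame_signal (hσ : 0 < σ) (i j : Fin 𝔐.n) :
    𝔐.Tame (fun p _ => expMomentBound σ C p) (fun v => v.2.2 i j) :=
  𝔐.tame_of_snd (f := fun x => x.2 i j) (by fun_prop) fun _ hp =>
    eLpNorm_le_expMomentBound hσ (𝔐.signal.signal_integrable i j) (𝔐.signal.signal_le i j) hp

end Model

/-! ### Scaling one entry of the noise -/

/-- Scale the entries `(i, l)` and `(l, i)` of a matrix by `t`. -/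
def scaleEntry {n : ℕ} (i l : Fin n) (t : ℝ) (X : Fin n → Fin n → ℝ) : Fin n → Fin n → ℝ :=
  fun a b => (if (a = i ∧ b = l) ∨ (a = l ∧ b = i) then t else 1) * X a b

section ScaleEntry

variable {n : ℕ} {i l l' : Fin n}

lemma scaleEntry_one (X : Fin n → Fin n → ℝ) : scaleEntry i l 1 X = X := by
  ext a b; simp [scaleEntry]

lemma scaleEntry_apply_of_ne (hl : l' ≠ l) (hi : l ≠ i) (t : ℝ) (X : Fin n → Fin n → ℝ) :
    scaleEntry i l t X i l' = X i l' := by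
  simp [scaleEntry, hl, hi.symm]

lemma scaleEntry_comm (t t' : ℝ) (X : Fin n → Fin n → ℝ) :
    scaleEntry i l t (scaleEntry i l' t' X) = scaleEntry i l' t' (scaleEntry i l t X) := by
  ext a b; simp only [scaleEntry]; ring

lemma measurable_scaleEntry (i l : Fin n) (t : ℝ) :
    Measurable fun X : Fin n → Fin n → ℝ => scaleEntry i l t X := by
  unfold scaleEntry; fun_prop

/-- The pair `{i, l}` in increasing order. -/
def edge (i l : Fin n) : Fin n × Fin n := (min i l, max i l)

lemma edge_lt (h : l ≠ i) : (edge i l).1 < (edge i l).2 := by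
  simpa [edge] using h

/-- The scaling path is a straight line starting at the matrix with the entry erased; its velocity
is the entry times a coordinate direction. Off the diagonal this is a direction in which derivatives
are controlled. -/
lemma scaleEntry_eq_add {X : Matrix (Fin n) (Fin n) ℝ} (hX : X.IsSymm) (h : l ≠ i) (t : ℝ) :
    scaleEntry i l t X =
      fun a b => scaleEntry i l 0 X a b + t * X i l * entryDir (edge i l) a b := by
  have hs := hX.apply i l
  have key : ∀ a b, entryDir (edge i l) a b =
      if (a = i ∧ b = l) ∨ (a = l ∧ b = i) then 1 else 0 := by
    intro a b
    rcases le_total i l with hle | hle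
    · simp only [edge, entryDir, min_eq_left hle, max_eq_right hle, Matrix.add_apply,
        Matrix.single_apply]
      grind
    · simp only [edge, entryDir, min_eq_right hle, max_eq_left hle, Matrix.add_apply,
        Matrix.single_apply]
      grind
  ext a b
  simp only [key, scaleEntry]
  split_ifs with hab
  · rcases hab with ⟨rfl, rfl⟩ | ⟨rfl, rfl⟩
    · ring
    · rw [hs]; ring
  · ring

end ScaleEntry

/-! ### Independence of unused entries -/

/-- The joint law of the triple is a product of three laws, and products of measures can be
rebracketed. -/
lemma IndepFun.prodMk_of_prodMk {Ω α β γ : Type*} [MeasurableSpace Ω] [MeasurableSpace α]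
    [MeasurableSpace β] [MeasurableSpace γ] {μ : Measure Ω} [IsProbabilityMeasure μ]
    {f : Ω → α} {g : Ω → β} {h : Ω → γ} (hf : Measurable f) (hg : Measurable g)
    (hh : Measurable h) (hfg : IndepFun f g μ) (hfgh : IndepFun (fun ω => (f ω, g ω)) h μ) :
    IndepFun f (fun ω => (g ω, h ω)) μ := by
  have := Measure.isProbabilityMeasure_map (μ := μ) hf.aemeasurable
  have := Measure.isProbabilityMeasure_map (μ := μ) hg.aemeasurable
  have := Measure.isProbabilityMeasure_map (μ := μ) hh.aemeasurable
  have hgh : IndepFun g h μ := hfgh.comp measurable_snd measurable_id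
  rw [indepFun_iff_map_prod_eq_prod_map_map hf.aemeasurable (hg.prodMk hh).aemeasurable,
    (indepFun_iff_map_prod_eq_prod_map_map hg.aemeasurable hh.aemeasurable).1 hgh,
    ← Measure.prodAssoc_prod,
    ← (indepFun_iff_map_prod_eq_prod_map_map hf.aemeasurable hg.aemeasurable).1 hfg,
    ← (indepFun_iff_map_prod_eq_prod_map_map (hf.prodMk hg).aemeasurable hh.aemeasurable).1 hfgh,
    Measure.map_map (by fun_prop) ((hf.prodMk hg).prodMk hh)]
  rfl

namespace Model

variable {𝔐 : Model.{u} σ C} {A : 𝔐.Ω → Matrix (Fin 𝔐.n) (Fin 𝔐.n) ℝ}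

/-- Scaling an entry by a factor in `[0, 1]` preserves the class of noise matrices. -/
lemma Noise.scaleEntry (hA : 𝔐.Noise A) (i l : Fin 𝔐.n) {t : ℝ} (h0 : 0 ≤ t) (h1 : t ≤ 1) :
    𝔐.Noise (fun ω => scaleEntry i l t (A ω)) where
  measurable a b := (hA.measurable a b).const_mul _
  symm ω := by
    refine Matrix.IsSymm.ext fun a b => ?_
    simp only [AMP.scaleEntry]
    rw [(hA.symm ω).apply]
    congr 2
    grind
  indep_entries := hA.indep_entries.comp
    (fun e x => (if (e.1.1 = i ∧ e.1.2 = l) ∨ (e.1.1 = l ∧ e.1.2 = i) then t else 1) * x)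
    fun e => measurable_const_mul _
  centered a b := by
    simp only [AMP.scaleEntry]
    rw [integral_const_mul, hA.centered, mul_zero]
  subgaussian a b := by
    obtain ⟨s, hs, hsub⟩ := hA.subgaussian a b
    simp only [AMP.scaleEntry]
    set c : ℝ := if (a = i ∧ b = l) ∨ (a = l ∧ b = i) then t else 1 with hc
    have hc0 : 0 ≤ c := by rw [hc]; split_ifs <;> linarith
    have hc1 : c ≤ 1 := by rw [hc]; split_ifs <;> linarith
    refine ⟨⟨c, hc0⟩ * s, ?_, ?_⟩
    · exact (mul_le_of_le_one_left s.2 hc1).trans hs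
    · convert hsub.const_mul c using 1
      exact NNReal.eq (mul_pow c (s : ℝ) 2)
  indep_signal := hA.indep_signal.comp (φ := fun x e =>
    (if (e.1 = i ∧ e.2 = l) ∨ (e.1 = l ∧ e.2 = i) then t else 1) * x e) (ψ := id)
    (by fun_prop) measurable_id

variable (𝔐) in
/-- The entries `(i, l)`, `l ∉ J`, are each independent of the weight `ξ` and the rest of the
configuration. -/
def Fresh (A : 𝔐.Ω → Matrix (Fin 𝔐.n) (Fin 𝔐.n) ℝ) (i : Fin 𝔐.n) (J : Finset (Fin 𝔐.n))
    (ξ : 𝔐.Ω → ℝ) : Prop :=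
  ∀ l ∉ J, IndepFun (fun ω => A ω i l)
    (fun ω => (ξ ω, 𝔐.config (fun ω => AMP.scaleEntry i l 0 (A ω)) ω)) 𝔐.μ

/-- The initial state of the expansion: trivial weight, and only the diagonal index counted as used,
so that no diagonal entry is ever expanded. Independence among the upper triangular entries is
combined with independence of noise and signal. -/
lemma Noise.fresh (hA : 𝔐.Noise A) (i : Fin 𝔐.n) : 𝔐.Fresh A i {i} fun _ => 1 := by
  intro l hl
  rw [Finset.mem_singleton] at hl
  have hθ : Measurable fun ω => (𝔐.u0 ω, fun e : Fin 𝔐.n × Fin 𝔐.n => 𝔐.Z ω e.1 e.2) :=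
    Measurable.prodMk (measurable_pi_lambda _ 𝔐.signal.measurable_init)
      (measurable_pi_lambda _ fun e => 𝔐.signal.measurable_signal e.1 e.2)
  have hX : Measurable fun ω a b => A ω a b :=
    measurable_pi_lambda _ fun a => measurable_pi_lambda _ fun b => hA.measurable a b
  let Idx := {e : Fin 𝔐.n × Fin 𝔐.n // e.1 ≤ e.2}
  let srt : Fin 𝔐.n → Fin 𝔐.n → Idx := fun a b => ⟨edge a b, min_le_max⟩
  have hsrt : ∀ ω a b, A ω (srt a b).1.1 (srt a b).1.2 = A ω a b := by
    intro ω a b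
    rcases le_total a b with h | h
    · simp [srt, edge, h]
    · simp [srt, edge, h, (hA.symm ω).apply]
  -- Every position other than `(i, l)` and `(l, i)` is represented in the upper triangle by an
  -- index different from that of the erased entry, so it is a function of the remaining independent
  -- family.
  have hne : ∀ a b, ¬((a = i ∧ b = l) ∨ (a = l ∧ b = i)) →
      srt a b ∈ Finset.univ.erase (srt i l) := by
    intro a b hab
    refine Finset.mem_erase.2 ⟨fun h => hab ?_, Finset.mem_univ _⟩
    have h' := congrArg Subtype.val h
    simp only [srt, edge, Prod.mk.injEq] at h'
    rcases le_total a b with h1 | h1 <;> rcases le_total i l with h2 | h2 <;>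
      simp only [h1, h2, min_eq_left, min_eq_right, max_eq_left, max_eq_right] at h' <;> tauto
  have hind := hA.indep_entries.indepFun_finset {srt i l} (Finset.univ.erase (srt i l))
    (by simp) (fun e => hA.measurable _ _)
  have h1 : IndepFun (fun ω => A ω i l)
      (fun ω => AMP.scaleEntry i l 0 (A ω)) 𝔐.μ := by
    have hφ : Measurable fun x : ({srt i l} : Finset Idx) → ℝ =>
        x ⟨srt i l, Finset.mem_singleton_self _⟩ := measurable_pi_apply _
    have hψ : Measurable fun (y : (Finset.univ.erase (srt i l) : Finset Idx) → ℝ) a b =>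
        if h : (a = i ∧ b = l) ∨ (a = l ∧ b = i) then 0 else y ⟨srt a b, hne a b h⟩ := by
      refine measurable_pi_lambda _ fun a => measurable_pi_lambda _ fun b => ?_
      by_cases h : (a = i ∧ b = l) ∨ (a = l ∧ b = i)
      · simp only [h, dite_true]; exact measurable_const
      · simp only [h, dite_false]; exact measurable_pi_apply _
    have := hind.comp hφ hψ
    convert this using 1
    · funext ω; exact (hsrt ω i l).symm
    · funext ω a b
      by_cases h : (a = i ∧ b = l) ∨ (a = l ∧ b = i)
      · simp [AMP.scaleEntry, h]
      · simp [AMP.scaleEntry, h, hsrt]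
  have h2 : IndepFun
      (fun ω => (A ω i l, AMP.scaleEntry i l 0 (A ω)))
      (fun ω => (𝔐.u0 ω, fun e : Fin 𝔐.n × Fin 𝔐.n => 𝔐.Z ω e.1 e.2)) 𝔐.μ :=
    hA.indep_signal.comp (φ := fun x => (x (i, l),
      fun a b => (if (a = i ∧ b = l) ∨ (a = l ∧ b = i) then 0 else 1) * x (a, b)))
      (ψ := id) (by fun_prop) measurable_id
  have h3 := IndepFun.prodMk_of_prodMk (hA.measurable i l)
    ((measurable_scaleEntry i l 0).comp hX) hθ h1 h2
  exact h3.comp (φ := id) (ψ := fun y => ((1 : ℝ), (y.1, y.2.1, fun a b => y.2.2 (a, b))))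
    measurable_id (by fun_prop)

/-- Erasing an unused entry `(i, l')` leaves the used entry `(i, l)` unchanged, so the enlarged
weight is still a function of the old weight and the erased configuration. -/
lemma Fresh.mul_entry {i : Fin 𝔐.n} {J : Finset (Fin 𝔐.n)} {ξ : 𝔐.Ω → ℝ}
    (hf : 𝔐.Fresh A i J ξ) (hi : i ∈ J) {l : Fin 𝔐.n} (hl : l ∈ J) :
    𝔐.Fresh A i J fun ω => ξ ω * A ω i l := by
  intro l' hl'
  have h1 : l ≠ l' := fun h => hl' (h ▸ hl)
  have h2 : l' ≠ i := fun h => hl' (h ▸ hi)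
  convert (hf l' hl').comp (φ := id) (ψ := fun y : ℝ × Config 𝔐.n => (y.1 * y.2.1 i l, y.2)) measurable_id
    (by fun_prop) using 1
  · rfl
  · funext ω
    exact Prod.ext (congrArg (ξ ω * ·) (scaleEntry_apply_of_ne h1 h2 0 (A ω)).symm) rfl

/-- Rescaling one entry commutes with erasing another. The weight keeps the square of the original,
unscaled entry, as it appears in the Taylor remainder; the price is that `l` becomes used. -/
lemma Fresh.scaleEntry {i : Fin 𝔐.n} {J : Finset (Fin 𝔐.n)} {ξ : 𝔐.Ω → ℝ}
    (hf : 𝔐.Fresh A i J ξ) (hi : i ∈ J) {l : Fin 𝔐.n} (hl : l ∉ J) (t : ℝ) :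
    𝔐.Fresh (fun ω => scaleEntry i l t (A ω)) i (insert l J) fun ω => ξ ω * A ω i l ^ 2 := by
  intro l' hl'
  rw [Finset.mem_insert, not_or] at hl'
  have h0 : l ≠ i := fun h => hl (h ▸ hi)
  have h2 : l' ≠ i := fun h => hl'.2 (h ▸ hi)
  convert (hf l' hl'.2).comp (φ := id) (ψ := fun y : ℝ × Config 𝔐.n =>
    (y.1 * y.2.1 i l ^ 2, (AMP.scaleEntry i l t y.2.1, y.2.2)))
    measurable_id (by
      have h := measurable_scaleEntry i l t
      exact Measurable.prodMk (by fun_prop) (Measurable.prodMk (h.comp (by fun_prop))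
        (by fun_prop))) using 1
  · funext ω
    exact scaleEntry_apply_of_ne hl'.1 h0 t (A ω)
  · funext ω
    exact Prod.ext (congrArg (ξ ω * · ^ 2)
      (scaleEntry_apply_of_ne (Ne.symm hl'.1) h2 0 (A ω)).symm)
      (Prod.ext (scaleEntry_comm 0 t (A ω)) rfl)

end Model

/-! ### Moments of normalized row sums -/

lemma abs_integral_le_of_eLpNorm_le {Ω : Type*} [MeasurableSpace Ω] {μ : Measure Ω} {f : Ω → ℝ}
    {K : ℝ≥0} (h : eLpNorm f ((1 : ℕ) : ℝ≥0∞) μ ≤ K) : |∫ ω, f ω ∂μ| ≤ K := by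
  rw [Nat.cast_one, eLpNorm_one_eq_lintegral_enorm] at h
  have h1 := (enorm_integral_le_lintegral_enorm (μ := μ) f).trans h
  rw [Real.enorm_eq_ofReal_abs] at h1
  simpa using ENNReal.toReal_mono (by simp) h1

namespace Model

section

variable {𝔐 : Model.{u} σ C} {A : 𝔐.Ω → Matrix (Fin 𝔐.n) (Fin 𝔐.n) ℝ} {B B' : ℕ → ℕ → ℝ≥0}
  {g h : Config 𝔐.n → ℝ} {D : ℕ → ℝ≥0} {ξ : 𝔐.Ω → ℝ}

variable (𝔐) in
lemma tame_const (c : ℝ) : 𝔐.Tame (fun _ _ => ‖c‖₊) (fun _ => c) :=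
  𝔐.tame_of_snd (f := fun _ => c) contDiff_const fun p hp => by
    rw [eLpNorm_const _ (by exact_mod_cast (by omega : p ≠ 0)) (IsProbabilityMeasure.ne_zero 𝔐.μ)]
    simp

variable (𝔐) in
/-- `h` has controlled derivatives, with bounds that may depend on the model. -/
def Mild (h : Config 𝔐.n → ℝ) : Prop := ∃ B, 𝔐.Tame B h

lemma Tame.mild (hh : 𝔐.Tame B h) : 𝔐.Mild h := ⟨B, hh⟩

lemma Mild.smooth (hh : 𝔐.Mild h) : ContDiff ℝ ∞ₛ h := hh.choose_spec.smooth

lemma Mild.mul (hg : 𝔐.Mild g) (hh : 𝔐.Mild h) : 𝔐.Mild fun v => g v * h v := by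
  obtain ⟨B, hB⟩ := hg
  obtain ⟨B', hB'⟩ := hh
  obtain ⟨B'', h''⟩ := exists_tame_mul.{u} (σ := σ) (C := C) B B'
  exact ⟨B'', h'' 𝔐 _ _ hB hB'⟩

lemma Mild.scaledDeriv (hh : 𝔐.Mild h) {e : Fin 𝔐.n × Fin 𝔐.n} (he : e.1 < e.2) :
    𝔐.Mild (scaledDeriv e h) := (hh.choose_spec.scaledDeriv he).mild

lemma Mild.sum {ι : Type*} (s : Finset ι) {f : ι → Config 𝔐.n → ℝ} (hf : ∀ j, 𝔐.Mild (f j)) :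
    𝔐.Mild fun v => ∑ j ∈ s, f j v := by
  classical
  induction s using Finset.induction_on with
  | empty => simpa using (𝔐.tame_const 0).mild
  | insert j s hj ih =>
    simp_rw [Finset.sum_insert hj]
    exact ((hf j).choose_spec.add ih.choose_spec).mild

lemma Mild.prod {ι : Type*} (s : Finset ι) {f : ι → Config 𝔐.n → ℝ} (hf : ∀ j, 𝔐.Mild (f j)) :
    𝔐.Mild fun v => ∏ j ∈ s, f j v := by
  classical
  induction s using Finset.induction_on with
  | empty => simpa using (𝔐.tame_const 1).mild
  | insert j s hj ih =>
    simp_rw [Finset.prod_insert hj]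
    exact (hf j).mul ih

-- The scaled derivative of an entry has size `√n`, so these bounds are not uniform in `n`. They
-- serve only to justify integrability, which is the role of `Mild`.
variable (𝔐) in
lemma mild_noise (i j : Fin 𝔐.n) : 𝔐.Mild fun v => v.1 i j := by
  refine ⟨fun p m => m.casesOn (expMomentBound 1 (2 * Real.exp (σ ^ 2 / 2)) p)
    fun _ => ∑ e : Fin 𝔐.n × Fin 𝔐.n, ‖√(𝔐.n : ℝ) * entryDir e i j‖₊, fun M => ?_⟩
  cases M with
  | zero => exact controlled_zero (contDiff_noise i j) fun A hA p hp => hA.eLpNorm_entry_le i j hp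
  | succ M =>
    refine Controlled.of_scaledDeriv (contDiff_noise i j)
      (fun A hA p hp => hA.eLpNorm_entry_le i j hp) fun e he => ?_
    rw [scaledDeriv_noise]
    refine (𝔐.tame_const _ M).mono fun p m => ?_
    exact Finset.single_le_sum (f := fun e => ‖√(𝔐.n : ℝ) * entryDir e i j‖₊)
      (fun _ _ => zero_le) (Finset.mem_univ e)

lemma Mild.rowSum (i : Fin 𝔐.n) {w : Fin 𝔐.n → Config 𝔐.n → ℝ} (hw : ∀ j, 𝔐.Mild (w j)) :
    𝔐.Mild (rowSum i w) :=
  (𝔐.tame_const _).mild.mul (Mild.sum _ fun j => (𝔐.mild_noise i j).mul (hw j))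

variable (𝔐) in
/-- A weight is a random variable whose moments are bounded by `D`. -/
structure IsWeight (D : ℕ → ℝ≥0) (ξ : 𝔐.Ω → ℝ) : Prop where
  measurable : Measurable ξ
  bound : ∀ p : ℕ, 1 ≤ p → eLpNorm ξ p 𝔐.μ ≤ D p

/-- Bound for the moments of a weight multiplied by an entry of the noise. -/
def mulEntryBound (σ : ℝ) (D : ℕ → ℝ≥0) (p : ℕ) : ℝ≥0 :=
  D (2 * p) * expMomentBound 1 (2 * Real.exp (σ ^ 2 / 2)) (2 * p)

lemma IsWeight.mul_entry (hξ : 𝔐.IsWeight D ξ) (hA : 𝔐.Noise A) (i l : Fin 𝔐.n) :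
    𝔐.IsWeight (mulEntryBound σ D) fun ω => ξ ω * A ω i l := by
  refine ⟨hξ.measurable.mul (hA.measurable i l), fun p hp => ?_⟩
  refine (eLpNorm_mul_le_two hξ.measurable.aestronglyMeasurable
    (hA.measurable i l).aestronglyMeasurable p).trans ?_
  rw [mulEntryBound, ENNReal.coe_mul]
  exact mul_le_mul' (hξ.bound _ (by omega)) (hA.eLpNorm_entry_le i l (by omega))

lemma IsWeight.eLpNorm_mul_le (hξ : 𝔐.IsWeight D ξ) (hA : 𝔐.Noise A) (hh : 𝔐.Tame B h) :
    eLpNorm (fun ω => ξ ω * h (𝔐.config A ω)) ((1 : ℕ) : ℝ≥0∞) 𝔐.μ ≤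
      ((D 2 * B 2 0 : ℝ≥0) : ℝ≥0∞) := by
  refine (eLpNorm_mul_le_two hξ.measurable.aestronglyMeasurable
    (hA.aestronglyMeasurable_comp hh.smooth) 1).trans ?_
  rw [ENNReal.coe_mul]
  exact mul_le_mul' (hξ.bound _ (by omega)) ((hh 0).eLpNorm_le hA (by omega))

lemma IsWeight.integrable_mul (hξ : 𝔐.IsWeight D ξ) (hA : 𝔐.Noise A) (hh : 𝔐.Mild h) :
    Integrable (fun ω => ξ ω * h (𝔐.config A ω)) 𝔐.μ := by
  rw [← memLp_one_iff_integrable]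
  refine ⟨(hξ.measurable.mul (hA.measurable_comp hh.smooth)).aestronglyMeasurable, ?_⟩
  have := hξ.eLpNorm_mul_le hA hh.choose_spec
  rw [Nat.cast_one] at this
  exact this.trans_lt ENNReal.coe_lt_top

lemma Noise.config_scaleEntry (hA : 𝔐.Noise A) {i l : Fin 𝔐.n} (hl : l ≠ i) (t : ℝ) (ω : 𝔐.Ω) :
    𝔐.config (fun ω => AMP.scaleEntry i l t (A ω)) ω =
      𝔐.config (fun ω => AMP.scaleEntry i l 0 (A ω)) ω + (t * A ω i l) • configDir (edge i l) := by
  refine Prod.ext (scaleEntry_eq_add (hA.symm ω) hl t) (Prod.ext ?_ ?_)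
  · simp [config, configDir]
  · have : 𝔐.Z ω = 𝔐.Z ω + (t * A ω i l) • (0 : Matrix (Fin 𝔐.n) (Fin 𝔐.n) ℝ) := by
      rw [smul_zero, add_zero]
    exact this

/-- Taylor expansion in a centered entry that is independent of everything else. -/
lemma Fresh.abs_integral_le {i : Fin 𝔐.n} {J : Finset (Fin 𝔐.n)} (hf : 𝔐.Fresh A i J ξ)
    (hA : 𝔐.Noise A) (hi : i ∈ J) {l : Fin 𝔐.n} (hl : l ∉ J) (hξ : 𝔐.IsWeight D ξ)
    (hh : 𝔐.Mild h) {K : ℝ}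
    (hK : ∀ t : ℝ, 0 ≤ t → t ≤ 1 → |∫ ω, ξ ω * A ω i l ^ 2 * scaledDeriv (edge i l) h
      (𝔐.config (fun ω => AMP.scaleEntry i l t (A ω)) ω) ∂𝔐.μ| ≤ K) :
    |∫ ω, ξ ω * A ω i l * h (𝔐.config A ω) ∂𝔐.μ| ≤ (√(𝔐.n : ℝ))⁻¹ * K := by
  have hli : l ≠ i := fun h => hl (h ▸ hi)
  have hn : (√(𝔐.n : ℝ)) ≠ 0 := by have := 𝔐.pos; positivity
  have hA0 := hA.scaleEntry i l le_rfl zero_le_one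
  have hξa := hξ.mul_entry hA i l
  have hξ2 : 𝔐.IsWeight (mulEntryBound σ (mulEntryBound σ D)) fun ω => ξ ω * A ω i l ^ 2 := by
    simpa only [pow_two, mul_assoc] using hξa.mul_entry hA i l
  have hd := hh.scaledDeriv (edge_lt hli)
  set H : 𝔐.Ω → ℝ → ℝ := fun ω t => ξ ω * A ω i l ^ 2 * scaledDeriv (edge i l) h
      (𝔐.config (fun ω => AMP.scaleEntry i l t (A ω)) ω) with hH
  have hmeas : Measurable (Function.uncurry H) := by
    have h1 : Measurable fun x : 𝔐.Ω × ℝ =>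
        𝔐.config (fun ω => AMP.scaleEntry i l x.2 (A ω)) x.1 := by
      rw [funext fun x : 𝔐.Ω × ℝ => hA.config_scaleEntry hli x.2 x.1]
      have := hA0.measurable_config
      have := hA.measurable i l
      fun_prop
    exact (hξ2.measurable.comp measurable_fst).mul (hd.smooth.continuous.measurable.comp h1)
  -- Fundamental theorem of calculus along the scaling path. The velocity supplies the second factor
  -- `a_{il}`, and replacing the plain derivative by the scaled one supplies `n^{-1/2}`.
  have hdiff : ∀ ω, ξ ω * A ω i l * h (𝔐.config A ω) -
      ξ ω * A ω i l * h (𝔐.config (fun ω => AMP.scaleEntry i l 0 (A ω)) ω) =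
      (√(𝔐.n : ℝ))⁻¹ * ∫ t in (0 : ℝ)..1, H ω t := by
    intro ω
    have hpath : ∀ t : ℝ, HasDerivAt
        (fun t : ℝ => ξ ω * A ω i l *
          h (𝔐.config (fun ω => AMP.scaleEntry i l t (A ω)) ω))
        ((√(𝔐.n : ℝ))⁻¹ * H ω t) t := by
      intro t
      have h1 : HasDerivAt (fun t : ℝ => 𝔐.config (fun ω => AMP.scaleEntry i l t (A ω)) ω)
          ((1 * A ω i l) • configDir (edge i l)) t := by
        rw [funext fun t => hA.config_scaleEntry hli t ω]
        exact (((hasDerivAt_id t).mul_const (A ω i l)).smul_const _).const_add _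
      have h2 := ((hh.smooth.differentiable (by simp)
        (𝔐.config (fun ω => AMP.scaleEntry i l t (A ω)) ω)).hasFDerivAt.comp_hasDerivAt t
          h1).const_mul (ξ ω * A ω i l)
      refine h2.congr_deriv ?_
      simp only [hH, scaledDeriv_eq_fderiv hh.smooth, map_smul, smul_eq_mul]
      field_simp
    have hcont : Continuous fun t => (√(𝔐.n : ℝ))⁻¹ * H ω t := by
      refine continuous_const.mul (continuous_const.mul (hd.smooth.continuous.comp ?_))
      rw [funext fun t => hA.config_scaleEntry hli t ω]
      fun_prop
    have h3 := intervalIntegral.integral_eq_sub_of_hasDerivAt (a := 0) (b := 1)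
      (fun t _ => hpath t) (hcont.intervalIntegrable 0 1)
    rw [intervalIntegral.integral_const_mul] at h3
    rw [h3]
    rw [funext fun ω => scaleEntry_one (i := i) (l := l) (A ω)]
  -- With the entry erased, everything but the centered factor `a_{il}` is independent of it.
  have hzero : ∫ ω, ξ ω * A ω i l *
      h (𝔐.config (fun ω => AMP.scaleEntry i l 0 (A ω)) ω) ∂𝔐.μ = 0 := by
    have h1 := (hf l hl).comp (φ := id) (ψ := fun y : ℝ × Config 𝔐.n => y.1 * h y.2)
      measurable_id (measurable_fst.mul (hh.smooth.continuous.measurable.comp measurable_snd))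
    have h2 := h1.integral_fun_mul_eq_mul_integral (hA.measurable i l).aestronglyMeasurable
      (hξ.measurable.mul (hA0.measurable_comp hh.smooth)).aestronglyMeasurable
    simp only [Function.comp_apply, id] at h2
    rw [hA.centered, zero_mul] at h2
    refine (integral_congr_ae (Filter.Eventually.of_forall fun ω => ?_)).trans h2
    ring
  -- Fubini applies because the `L¹` bound on `H` is the same for every `t`: all scaled matrices are
  -- admissible and share the bound `B`.
  have hint : Integrable (Function.uncurry H) (𝔐.μ.prod (volume.restrict (Set.Ioc (0 : ℝ) 1))) := by
    obtain ⟨B, hB⟩ := hd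
    have hb : ∀ t ∈ Set.Ioc (0 : ℝ) 1, ∫ ω, ‖H ω t‖ ∂𝔐.μ ≤
        ((mulEntryBound σ (mulEntryBound σ D) 2 * B 2 0 : ℝ≥0) : ℝ) := by
      intro t ht
      have h1 := hξ2.eLpNorm_mul_le (hA.scaleEntry i l ht.1.le ht.2) hB
      rw [← eLpNorm_norm] at h1
      exact (le_abs_self _).trans (abs_integral_le_of_eLpNorm_le h1)
    rw [integrable_prod_iff' hmeas.aestronglyMeasurable]
    constructor
    · refine (ae_restrict_iff' measurableSet_Ioc).2 (Filter.Eventually.of_forall fun t ht => ?_)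
      exact hξ2.integrable_mul (hA.scaleEntry i l ht.1.le ht.2) hB.mild
    · refine Integrable.of_bound (C := ((mulEntryBound σ (mulEntryBound σ D) 2 * B 2 0 : ℝ≥0) : ℝ))
        ?_ ((ae_restrict_iff' measurableSet_Ioc).2 (Filter.Eventually.of_forall fun t ht => ?_))
      · exact (hmeas.norm.stronglyMeasurable.integral_prod_left').aestronglyMeasurable
      · rw [Real.norm_of_nonneg (integral_nonneg fun _ => norm_nonneg _)]
        exact hb t ht
  have hswap : ∫ ω, (∫ t in (0 : ℝ)..1, H ω t) ∂𝔐.μ = ∫ t in (0 : ℝ)..1, ∫ ω, H ω t ∂𝔐.μ := by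
    simp_rw [intervalIntegral.integral_of_le (zero_le_one' ℝ)]
    exact integral_integral_swap hint
  have hfinal : ∫ ω, ξ ω * A ω i l * h (𝔐.config A ω) ∂𝔐.μ =
      (√(𝔐.n : ℝ))⁻¹ * ∫ t in (0 : ℝ)..1, ∫ ω, H ω t ∂𝔐.μ := by
    rw [← hswap, ← integral_const_mul]
    simp_rw [← hdiff]
    rw [integral_sub (hξa.integrable_mul hA hh) (hξa.integrable_mul hA0 hh), hzero, sub_zero]
  rw [hfinal, abs_mul, abs_of_nonneg (by positivity : (0 : ℝ) ≤ (√(𝔐.n : ℝ))⁻¹)]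
  gcongr
  have := intervalIntegral.norm_integral_le_of_norm_le_const (a := 0) (b := 1) (C := K)
    (f := fun t => ∫ ω, H ω t ∂𝔐.μ) fun t ht => by
      rw [Set.uIoc_of_le zero_le_one] at ht
      exact hK t ht.1.le ht.2
  simpa using this

end

end Model

/-- As `l ≠ i`, exactly one endpoint of the edge is `i`, and the released weight is the one at the
other endpoint. -/
lemma scaledDeriv_edge_rowSum {n : ℕ} (hn : 0 < n) {i l : Fin n} (hl : l ≠ i)
    {w : Fin n → Config n → ℝ} (hw : ∀ j, ContDiff ℝ ∞ₛ (w j)) :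
    scaledDeriv (edge i l) (rowSum i w) =
      fun v => rowSum i (fun j => scaledDeriv (edge i l) (w j)) v + w l v := by
  rw [scaledDeriv_rowSum hn i hw]
  funext v
  congr 1
  rcases lt_or_gt_of_ne hl with h | h
  · simp [edge, h.le, hl.symm]
  · simp [edge, h.le, hl.symm]

/-- The derivative of a product with row sums. -/
lemma scaledDeriv_mul_prod_rowSum {n : ℕ} (hn : 0 < n) {i l : Fin n} (hl : l ≠ i)
    {g : Config n → ℝ} (hg : ContDiff ℝ ∞ₛ g) {w : ℕ → Fin n → Config n → ℝ}
    (hw : ∀ s j, ContDiff ℝ ∞ₛ (w s j)) (T : Finset ℕ) :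
    scaledDeriv (edge i l) (fun v => g v * ∏ s ∈ T, rowSum i (w s) v) = fun v =>
      scaledDeriv (edge i l) g v * ∏ s ∈ T, rowSum i (w s) v +
      ∑ s ∈ T, (g v * ∏ r ∈ T, rowSum i
          (Function.update w s (fun j => scaledDeriv (edge i l) (w s j)) r) v +
        g v * w s l v * ∏ r ∈ T.erase s, rowSum i (w r) v) := by
  have hr : ∀ s, ContDiff ℝ ∞ₛ (rowSum i (w s)) := fun s => contDiff_rowSum i (hw s)
  rw [scaledDeriv_mul hg (contDiff_prod fun s _ => hr s), scaledDeriv_prod T hr]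
  funext v
  congr 1
  rw [Finset.mul_sum]
  refine Finset.sum_congr rfl fun s hs => ?_
  rw [scaledDeriv_edge_rowSum hn hl (hw s), ← Finset.mul_prod_erase T _ hs,
    Function.update_self]
  have : ∏ r ∈ T.erase s, rowSum i
      (Function.update w s (fun j => scaledDeriv (edge i l) (w s j)) r) v =
      ∏ r ∈ T.erase s, rowSum i (w r) v :=
    Finset.prod_congr rfl fun r hr => by rw [Function.update_of_ne (Finset.ne_of_mem_erase hr)]
  rw [this]
  ring

/-! ### Induction on the number of row sums -/

namespace Model

/-- Mixed moments of row sums are bounded, uniformly in the model. -/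
theorem exists_abs_integral_prod_rowSum_le (q N : ℕ) (B : ℕ → ℕ → ℝ≥0) (D : ℕ → ℝ≥0) :
    ∃ K : ℝ, 0 ≤ K ∧ ∀ (𝔐 : Model.{u} σ C) (A : 𝔐.Ω → Matrix (Fin 𝔐.n) (Fin 𝔐.n) ℝ)
      (i : Fin 𝔐.n) (J : Finset (Fin 𝔐.n)) (ξ : 𝔐.Ω → ℝ) (g : Config 𝔐.n → ℝ)
      (w : ℕ → Fin 𝔐.n → Config 𝔐.n → ℝ) (T : Finset ℕ),
      𝔐.Noise A → i ∈ J → J.card ≤ N → 𝔐.IsWeight D ξ → 𝔐.Fresh A i J ξ → 𝔐.Tame B g →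
      (∀ s j, 𝔐.Tame B (w s j)) → T.card ≤ q →
      |∫ ω, ξ ω * (g (𝔐.config A ω) * ∏ s ∈ T, rowSum i (w s) (𝔐.config A ω)) ∂𝔐.μ| ≤ K := by
  have key : ∀ (B : ℕ → ℕ → ℝ≥0) (D : ℕ → ℝ≥0) (𝔐 : Model.{u} σ C)
      (A : 𝔐.Ω → Matrix (Fin 𝔐.n) (Fin 𝔐.n) ℝ) (ξ : 𝔐.Ω → ℝ) (g : Config 𝔐.n → ℝ), 𝔐.Noise A →
      𝔐.IsWeight D ξ → 𝔐.Tame B g →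
      |∫ ω, ξ ω * g (𝔐.config A ω) ∂𝔐.μ| ≤ ((D 2 * B 2 0 : ℝ≥0) : ℝ) :=
    fun B D 𝔐 A ξ g hA hξ hg => abs_integral_le_of_eLpNorm_le (hξ.eLpNorm_mul_le hA hg)
  -- Each step may add a used index, enlarge the derivative bounds and multiply the weight by
  -- entries, so `N`, `B` and `D` must vary.
  induction q generalizing N B D with
  | zero =>
    refine ⟨_, NNReal.coe_nonneg (D 2 * B 2 0), ?_⟩
    intro 𝔐 A i J ξ g w T hA _ _ hξ _ hg _ hT
    obtain rfl := Finset.card_eq_zero.1 (Nat.le_zero.1 hT)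
    simpa using key B D 𝔐 A ξ g hA hξ hg
  | succ q ih =>
    obtain ⟨B₁, hB₁⟩ := exists_tame_mul.{u} (σ := σ) (C := C) B B
    obtain ⟨B₂, hB₂⟩ := exists_tame_mul.{u} (σ := σ) (C := C) B₁ B
    -- One common bound for all functions that occur after the expansion: the weights `w` and their
    -- derivatives, the product `g · w s₀ l` and its derivative, and that product times a further
    -- released weight.
    set B₃ : ℕ → ℕ → ℝ≥0 := fun p m =>
      B p m + B p (m + 1) + B₁ p m + B₁ p (m + 1) + B₂ p m with hB₃
    have le₀ : ∀ p m, B p m ≤ B₃ p m := fun p m => by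
      simp only [hB₃, add_assoc]; exact le_self_add
    have le₁ : ∀ p m, B p (m + 1) ≤ B₃ p m := fun p m => by
      simp only [hB₃]
      exact le_add_right (le_add_right (le_add_right le_add_self))
    have le₂ : ∀ p m, B₁ p m ≤ B₃ p m := fun p m => by
      simp only [hB₃]
      exact le_add_right (le_add_right le_add_self)
    have le₃ : ∀ p m, B₁ p (m + 1) ≤ B₃ p m := fun p m => by
      simp only [hB₃]
      exact le_add_right le_add_self
    have le₄ : ∀ p m, B₂ p m ≤ B₃ p m := fun p m => by
      simp only [hB₃]
      exact le_add_self
    obtain ⟨K₁, hK₁, h₁⟩ := ih N B₃ (mulEntryBound σ D)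
    obtain ⟨K₂, hK₂, h₂⟩ := ih (N + 1) B₃ (mulEntryBound σ (mulEntryBound σ D))
    -- The terms cover the empty product, at most `N` used indices, and the unused indices. For the
    -- latter the derivative falls on the prefactor (one `K₂`) or on one of at most `q` row sums,
    -- where it acts on the weights or releases one.
    refine ⟨((D 2 * B 2 0 : ℝ≥0) : ℝ) + N * K₁ + (K₂ + q * (K₂ + K₂)), by positivity, ?_⟩
    intro 𝔐 A i J ξ g w T hA hi hJ hξ hf hg hw hT
    rcases T.eq_empty_or_nonempty with rfl | ⟨s₀, hs₀⟩
    · have := key B D 𝔐 A ξ g hA hξ hg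
      have h0 : 0 ≤ N * K₁ + (K₂ + q * (K₂ + K₂)) := by positivity
      simp only [Finset.prod_empty, mul_one]
      linarith
    set T' := T.erase s₀ with hT'
    have hT'c : T'.card ≤ q := by rw [hT', Finset.card_erase_of_mem hs₀]; omega
    have hn := 𝔐.pos
    have hsq : (√(𝔐.n : ℝ)) ^ 2 = 𝔐.n := Real.sq_sqrt (by positivity)
    have hs1 : 1 ≤ √(𝔐.n : ℝ) := Real.one_le_sqrt.2 (by exact_mod_cast hn)
    have hgw : ∀ l, 𝔐.Tame B₁ fun v => g v * w s₀ l v := fun l => hB₁ 𝔐 _ _ hg (hw s₀ l)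
    have hrow : ∀ s, 𝔐.Mild (rowSum i (w s)) := fun s => Mild.rowSum i fun j => (hw s j).mild
    set G : Fin 𝔐.n → Config 𝔐.n → ℝ := fun l v =>
      g v * w s₀ l v * ∏ s ∈ T', rowSum i (w s) v with hG
    have hGm : ∀ l, 𝔐.Mild (G l) := fun l => (hgw l).mild.mul (Mild.prod T' hrow)
    have hsplit : ∫ ω, ξ ω * (g (𝔐.config A ω) *
        ∏ s ∈ T, rowSum i (w s) (𝔐.config A ω)) ∂𝔐.μ =
        (√(𝔐.n : ℝ))⁻¹ * ∑ l, ∫ ω, ξ ω * A ω i l * G l (𝔐.config A ω) ∂𝔐.μ := by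
      rw [← integral_finsetSum _ fun l _ => (hξ.mul_entry hA i l).integrable_mul hA (hGm l),
        ← integral_const_mul]
      congr 1
      funext ω
      rw [← Finset.mul_prod_erase T _ hs₀]
      simp only [rowSum, hG, Finset.mul_sum, Finset.sum_mul]
      refine Finset.sum_congr rfl fun l _ => ?_
      simp only [config]
      ring
    -- For a used index the entry is absorbed into the weight; the noise matrix and `J` stay the
    -- same.
    have hold : ∀ l ∈ J, |∫ ω, ξ ω * A ω i l * G l (𝔐.config A ω) ∂𝔐.μ| ≤ K₁ := fun l hl =>
      h₁ 𝔐 A i J _ _ w T' hA hi hJ (hξ.mul_entry hA i l) (hf.mul_entry hi hl)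
        ((hgw l).mono le₂) (fun s j => (hw s j).mono le₀) hT'c
    have hnew : ∀ l ∉ J, |∫ ω, ξ ω * A ω i l * G l (𝔐.config A ω) ∂𝔐.μ| ≤
        (√(𝔐.n : ℝ))⁻¹ * (K₂ + q * (K₂ + K₂)) := by
      intro l hl
      have hli : l ≠ i := fun h => hl (h ▸ hi)
      have he := edge_lt hli
      refine hf.abs_integral_le hA hi hl hξ (hGm l) fun t ht0 ht1 => ?_
      have hAt := hA.scaleEntry i l ht0 ht1
      have hξ2 : 𝔐.IsWeight (mulEntryBound σ (mulEntryBound σ D))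
          fun ω => ξ ω * A ω i l ^ 2 := by
        simpa only [pow_two, mul_assoc] using (hξ.mul_entry hA i l).mul_entry hA i l
      have hft := hf.scaleEntry hi hl t
      have hJ' : (insert l J).card ≤ N + 1 := (Finset.card_insert_le l J).trans (by omega)
      have hi' : i ∈ insert l J := Finset.mem_insert_of_mem hi
      have hw' : ∀ s j, 𝔐.Tame B₃ (w s j) := fun s j => (hw s j).mono le₀
      have hwu : ∀ s r j, 𝔐.Tame B₃
          (Function.update w s (fun j => scaledDeriv (edge i l) (w s j)) r j) := by
        intro s r j
        by_cases hrs : r = s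
        · subst hrs
          rw [Function.update_self]
          exact ((hw r j).scaledDeriv he).mono le₁
        · rw [Function.update_of_ne hrs]
          exact hw' r j
      have b₁ := h₂ 𝔐 _ i _ _ _ w T' hAt hi' hJ' hξ2 hft (((hgw l).scaledDeriv he).mono le₃) hw'
        hT'c
      -- A derivative of the weights keeps the number `T'.card` of row sums, while in `b₃` a
      -- released weight removes one more; both are within the induction hypothesis for `q`.
      have b₂ := fun s => h₂ 𝔐 _ i _ _ _ _ T' hAt hi' hJ' hξ2 hft ((hgw l).mono le₂) (hwu s) hT'c
      have b₃ := fun s => h₂ 𝔐 _ i _ _ _ w (T'.erase s) hAt hi' hJ' hξ2 hft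
        ((hB₂ 𝔐 _ _ (hgw l) (hw s l)).mono le₄) hw' ((Finset.card_erase_le).trans hT'c)
      have m₁ := hξ2.integrable_mul hAt (((hgw l).scaledDeriv he).mild.mul (Mild.prod T' hrow))
      have m₂ := fun s => hξ2.integrable_mul hAt ((hgw l).mild.mul (Mild.prod T' fun r =>
        Mild.rowSum i fun j => (hwu s r j).mild))
      have m₃ := fun s => hξ2.integrable_mul hAt
        ((hB₂ 𝔐 _ _ (hgw l) (hw s l)).mild.mul (Mild.prod (T'.erase s) hrow))
      rw [hG, scaledDeriv_mul_prod_rowSum hn hli (hgw l).smooth fun s j => (hw s j).smooth]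
      simp only [mul_add, Finset.mul_sum]
      rw [integral_add m₁ (integrable_finsetSum _ fun s _ => (m₂ s).fun_add (m₃ s)),
        integral_finsetSum _ fun s _ => (m₂ s).fun_add (m₃ s)]
      refine (abs_add_le _ _).trans (add_le_add b₁ ((Finset.abs_sum_le_sum_abs _ _).trans ?_))
      calc _ ≤ ∑ _s ∈ T', (K₂ + K₂) := Finset.sum_le_sum fun s _ => by
            rw [integral_add (m₂ s) (m₃ s)]
            exact (abs_add_le _ _).trans (add_le_add (b₂ s) (b₃ s))
        _ ≤ q * K₂ + q * K₂ := by
            rw [Finset.sum_const, nsmul_eq_mul, ← mul_add]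
            gcongr
    rw [hsplit, abs_mul, abs_of_nonneg (by positivity : (0 : ℝ) ≤ (√(𝔐.n : ℝ))⁻¹)]
    have hsum : ∑ l, |∫ ω, ξ ω * A ω i l * G l (𝔐.config A ω) ∂𝔐.μ| ≤
        N * K₁ + 𝔐.n * ((√(𝔐.n : ℝ))⁻¹ * (K₂ + q * (K₂ + K₂))) := by
      rw [← Finset.sum_add_sum_compl J]
      refine add_le_add ((Finset.sum_le_sum hold).trans ?_)
        ((Finset.sum_le_sum fun l hl => hnew l (Finset.mem_compl.1 hl)).trans ?_)
      · rw [Finset.sum_const, nsmul_eq_mul]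
        gcongr
      · rw [Finset.sum_const, nsmul_eq_mul]
        gcongr
        simpa using Finset.card_le_univ Jᶜ
    calc (√(𝔐.n : ℝ))⁻¹ * |∑ l, ∫ ω, ξ ω * A ω i l * G l (𝔐.config A ω) ∂𝔐.μ|
        ≤ (√(𝔐.n : ℝ))⁻¹ * (N * K₁ + 𝔐.n * ((√(𝔐.n : ℝ))⁻¹ * (K₂ + q * (K₂ + K₂)))) := by
          gcongr
          exact (Finset.abs_sum_le_sum_abs _ _).trans hsum
      _ = (√(𝔐.n : ℝ))⁻¹ * (N * K₁) + (K₂ + q * (K₂ + K₂)) := by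
          have : (√(𝔐.n : ℝ)) ≠ 0 := by positivity
          rw [← hsq]
          simp only [Real.sqrt_sq (Real.sqrt_nonneg _)]
          field_simp
      _ ≤ 1 * (N * K₁) + (K₂ + q * (K₂ + K₂)) := by
          gcongr
          exact inv_le_one_of_one_le₀ hs1
      _ ≤ _ := by
          have := NNReal.coe_nonneg (D 2 * B 2 0)
          linarith

/-- Moments of row sums are bounded, uniformly in the model. -/
theorem exists_eLpNorm_rowSum_le (B : ℕ → ℕ → ℝ≥0) (p : ℕ) (hp : 1 ≤ p) :
    ∃ K : ℝ≥0, ∀ (𝔐 : Model.{u} σ C) (i : Fin 𝔐.n) (w : Fin 𝔐.n → Config 𝔐.n → ℝ),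
      (∀ j, 𝔐.Tame B (w j)) → ∀ A, 𝔐.Noise A →
        eLpNorm (fun ω => rowSum i w (𝔐.config A ω)) p 𝔐.μ ≤ K := by
  -- The even exponent `2p` makes the absolute moment a mixed moment of `2p` equal row sums. Here `N
  -- = 1` because `J = {i}`, and the added `1` makes the constant prefactor admissible.
  obtain ⟨K, hK, h⟩ := exists_abs_integral_prod_rowSum_le.{u} (σ := σ) (C := C) (2 * p) 1
    (fun p m => B p m + 1) (fun _ => 1)
  refine ⟨K.toNNReal ^ (1 / ((2 * p : ℕ) : ℝ)), fun 𝔐 i w hw A hA => ?_⟩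
  have hr : 𝔐.Mild (rowSum i w) := Mild.rowSum i fun j => (hw j).mild
  have hone : 𝔐.IsWeight (fun _ => 1) fun _ => 1 :=
    ⟨measurable_const, fun p hp => by
      rw [eLpNorm_const _ (by exact_mod_cast (by omega : p ≠ 0))
        (IsProbabilityMeasure.ne_zero 𝔐.μ)]
      simp⟩
  have h1 := h 𝔐 A i {i} _ (fun _ => 1) (fun _ => w) (Finset.range (2 * p)) hA
    (Finset.mem_singleton_self i) (by simp) hone (hA.fresh i)
    ((𝔐.tame_const 1).mono fun p m => by simp)
    (fun s j => (hw j).mono fun p m => le_self_add) (by simp)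
  simp only [one_mul, Finset.prod_const, Finset.card_range] at h1
  have hint : Integrable (fun ω => rowSum i w (𝔐.config A ω) ^ (2 * p)) 𝔐.μ := by
    simpa using hone.integrable_mul hA (Mild.prod (Finset.range (2 * p)) fun _ => hr)
  refine (eLpNorm_le_eLpNorm_of_exponent_le (q := ((2 * p : ℕ) : ℝ≥0∞))
    (by exact_mod_cast (by omega : p ≤ 2 * p)) (hA.aestronglyMeasurable_comp hr.smooth)).trans ?_
  refine eLpNorm_le_of_pow_le (by omega) hint (fun ω => ?_) ((le_abs_self _).trans h1)
  rw [(even_two_mul p).pow_abs]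

/-- A derivative of a row sum is a row sum of tame weights plus released weights. The moment bound
for row sums is therefore needed only at order zero, with shifted bounds for the differentiated
weights. -/
lemma exists_controlled_rowSum (M : ℕ) (B : ℕ → ℕ → ℝ≥0) :
    ∃ B' : ℕ → ℕ → ℝ≥0, ∀ (𝔐 : Model.{u} σ C) (i : Fin 𝔐.n) (w : Fin 𝔐.n → Config 𝔐.n → ℝ),
      (∀ j, 𝔐.Tame B (w j)) → 𝔐.Controlled M B' (rowSum i w) := by
  have key : ∀ B : ℕ → ℕ → ℝ≥0, ∃ K : ℕ → ℝ≥0, ∀ (𝔐 : Model.{u} σ C) (i : Fin 𝔐.n)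
      (w : Fin 𝔐.n → Config 𝔐.n → ℝ), (∀ j, 𝔐.Tame B (w j)) → ∀ A, 𝔐.Noise A → ∀ p : ℕ, 1 ≤ p →
        eLpNorm (fun ω => rowSum i w (𝔐.config A ω)) p 𝔐.μ ≤ K p := by
    intro B
    choose K hK using exists_eLpNorm_rowSum_le.{u} (σ := σ) (C := C) B
    refine ⟨fun p => if hp : 1 ≤ p then K p hp else 0, fun 𝔐 i w hw A hA p hp => ?_⟩
    simpa [hp] using hK p hp 𝔐 i w hw A hA
  induction M generalizing B with
  | zero =>
    obtain ⟨K, hK⟩ := key B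
    exact ⟨fun p _ => K p, fun 𝔐 i w hw => controlled_zero
      (contDiff_rowSum i fun j => (hw j).smooth) (hK 𝔐 i w hw)⟩
  | succ M ih =>
    obtain ⟨K, hK⟩ := key B
    obtain ⟨B₁, h₁⟩ := ih fun p m => B p (m + 1)
    refine ⟨fun p m => m.casesOn (K p) fun m => B₁ p m + (B p m + B p m),
      fun 𝔐 i w hw => Controlled.of_scaledDeriv (contDiff_rowSum i fun j => (hw j).smooth)
        (hK 𝔐 i w hw) fun e he => ?_⟩
    rw [scaledDeriv_rowSum 𝔐.pos i fun j => (hw j).smooth]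
    refine (h₁ 𝔐 i _ fun j => (hw j).scaledDeriv he).add (Controlled.add ?_ ?_)
    · by_cases h : i = e.1
      · simpa [h] using hw e.2 M
      · simpa [h] using controlled_zero_fun
    · by_cases h : i = e.2
      · simpa [h] using hw e.1 M
      · simpa [h] using controlled_zero_fun

lemma exists_tame_rowSum (B : ℕ → ℕ → ℝ≥0) :
    ∃ B' : ℕ → ℕ → ℝ≥0, ∀ (𝔐 : Model.{u} σ C) (i : Fin 𝔐.n) (w : Fin 𝔐.n → Config 𝔐.n → ℝ),
      (∀ j, 𝔐.Tame B (w j)) → 𝔐.Tame B' (rowSum i w) := by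
  choose B' hB using fun M => exists_controlled_rowSum.{u} (σ := σ) (C := C) M B
  exact ⟨_, fun 𝔐 i w hw => tame_of_forall fun M => hB M 𝔐 i w hw⟩

end Model

/-! ### The orbit -/

/-- The orbit as a function of the configuration. -/
def orbitFn {n : ℕ} (F : (k : ℕ) → (Fin (k + 1) → ℝ) → ℝ) (k : ℕ) (i : Fin n) (v : Config n) : ℝ :=
  orbit F v.2.2 v.2.1 v.1 k i

/-- The orbit multiplied by the normalized matrix, as a function of the configuration. -/
def hatOrbitFn {n : ℕ} (F : (k : ℕ) → (Fin (k + 1) → ℝ) → ℝ) (k : ℕ) (i : Fin n)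
    (v : Config n) : ℝ :=
  (hat v.1 v.2.2 *ᵥ orbit F v.2.2 v.2.1 v.1 k) i

lemma orbit_zero {n : ℕ} (F : (k : ℕ) → (Fin (k + 1) → ℝ) → ℝ) (Z : Matrix (Fin n) (Fin n) ℝ)
    (u0 : Fin n → ℝ) (X : Matrix (Fin n) (Fin n) ℝ) : orbit F Z u0 X 0 = u0 := by
  rw [orbit]

lemma orbit_succ {n : ℕ} (F : (k : ℕ) → (Fin (k + 1) → ℝ) → ℝ) (Z : Matrix (Fin n) (Fin n) ℝ)
    (u0 : Fin n → ℝ) (X : Matrix (Fin n) (Fin n) ℝ) (k : ℕ) (i : Fin n) :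
    orbit F Z u0 X (k + 1) i = F k (Fin.snoc (α := fun _ => ℝ)
      (fun j : Fin k => orbit F Z u0 X j i) ((hat X Z *ᵥ orbit F Z u0 X k) i)) := by
  rw [orbit]

lemma hat_mulVec_apply {n : ℕ} (X Z : Matrix (Fin n) (Fin n) ℝ) (u : Fin n → ℝ) (i : Fin n) :
    (hat X Z *ᵥ u) i = (√n)⁻¹ * ∑ j, X i j * u j + (n : ℝ)⁻¹ * ∑ j, Z i j * u j := by
  rw [hat, Matrix.add_mulVec, Matrix.smul_mulVec, Matrix.smul_mulVec]
  rfl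

lemma orbitFn_zero {n : ℕ} (F : (k : ℕ) → (Fin (k + 1) → ℝ) → ℝ) (i : Fin n) :
    orbitFn F 0 i = fun v => v.2.1 i := by
  funext v
  exact congrFun (orbit_zero F v.2.2 v.2.1 v.1) i

lemma orbitFn_succ {n : ℕ} (F : (k : ℕ) → (Fin (k + 1) → ℝ) → ℝ) (k : ℕ) (i : Fin n) :
    orbitFn F (k + 1) i = fun v => F k fun j =>
      (Fin.snoc (α := fun _ => Config n → ℝ) (fun j : Fin k => orbitFn F j i)
        (hatOrbitFn F k i) j) v := by
  funext v
  refine (orbit_succ F v.2.2 v.2.1 v.1 k i).trans (congrArg (F k) (funext fun j => ?_))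
  refine Fin.lastCases ?_ (fun j => ?_) j
  · simp only [Fin.snoc_last]; rfl
  · simp only [Fin.snoc_castSucc]; rfl

lemma hatOrbitFn_eq {n : ℕ} (F : (k : ℕ) → (Fin (k + 1) → ℝ) → ℝ) (k : ℕ) (i : Fin n) :
    hatOrbitFn F k i = fun v =>
      rowSum i (orbitFn F k) v + (n : ℝ)⁻¹ * ∑ j, v.2.2 i j * orbitFn F k j v := by
  funext v
  exact hat_mulVec_apply v.1 v.2.2 _ i

namespace Model

/-- The noise part is a row sum. The signal part is an empirical mean of products of tame functions,
so its normalization `1/n` needs no cancellation. -/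
lemma exists_tame_hatOrbitFn (hσ : 0 < σ) (F : (k : ℕ) → (Fin (k + 1) → ℝ) → ℝ) (k : ℕ)
    (B : ℕ → ℕ → ℝ≥0) :
    ∃ B' : ℕ → ℕ → ℝ≥0, ∀ 𝔐 : Model.{u} σ C, (∀ i, 𝔐.Tame B (orbitFn F k i)) →
      ∀ i, 𝔐.Tame B' (hatOrbitFn F k i) := by
  obtain ⟨B₁, h₁⟩ := exists_tame_rowSum.{u} (σ := σ) (C := C) B
  obtain ⟨B₂, h₂⟩ := exists_tame_mul.{u} (σ := σ) (C := C) (fun p _ => expMomentBound σ C p) B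
  refine ⟨fun p m => B₁ p m + B₂ p m, fun 𝔐 h i => ?_⟩
  rw [hatOrbitFn_eq]
  exact (h₁ 𝔐 i _ h).add (Tame.mean fun j => h₂ 𝔐 _ _ (𝔐.tame_signal hσ i j) (h j))

lemma exists_tame_orbitFn (hσ : 0 < σ) {F : (k : ℕ) → (Fin (k + 1) → ℝ) → ℝ}
    (hF : ∀ k, SmoothBddDeriv (F k)) (k : ℕ) :
    ∃ B : ℕ → ℕ → ℝ≥0, ∀ (𝔐 : Model.{u} σ C) (i : Fin 𝔐.n), 𝔐.Tame B (orbitFn F k i) := by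
  induction k using Nat.strong_induction_on with
  | _ k ih =>
    cases k with
    | zero => exact ⟨_, fun 𝔐 i => by rw [orbitFn_zero]; exact 𝔐.tame_init hσ i⟩
    | succ k =>
      choose B hB using fun j : Fin (k + 1) => ih j j.2
      obtain ⟨B', hB'⟩ := exists_tame_hatOrbitFn.{u} (C := C) hσ F k (B (Fin.last k))
      obtain ⟨B'', hB''⟩ := exists_tame_comp.{u} (σ := σ) (C := C) (hF k)
        -- The composition bound requires one bound for all arguments of `F k`; this sum dominates
        -- those of the earlier iterates and of the matrix product.
        fun p m => (∑ j, B j p m) + B' p m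
      refine ⟨B'', fun 𝔐 i => ?_⟩
      rw [orbitFn_succ]
      refine hB'' 𝔐 _ fun j => ?_
      refine Fin.lastCases ?_ (fun j => ?_) j
      · rw [Fin.snoc_last]
        exact (hB' 𝔐 (hB (Fin.last k) 𝔐) i).mono fun p m => le_add_self
      · rw [Fin.snoc_castSucc]
        exact (hB j.castSucc 𝔐 i).mono fun p m => le_add_right
          (Finset.single_le_sum (f := fun j => B j p m) (fun _ _ => zero_le) (Finset.mem_univ _))

end Model

/-! ### Conversion of the bounds -/

lemma sqrt_pow_eq_rpow {x : ℝ} (hx : 0 ≤ x) (m : ℕ) : √x ^ m = x ^ ((m : ℝ) / 2) := by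
  rw [Real.sqrt_eq_rpow, ← Real.rpow_natCast, ← Real.rpow_mul hx]
  congr 1
  ring

/-- On a probability space the moment of real order `p` is dominated by one of natural order `q ≥
p`; dividing by `c` later undoes the scaling by `√n ^ m`. -/
lemma momentLE_of_eLpNorm_le {Ω : Type*} [MeasurableSpace Ω] {μ : Measure Ω}
    [IsProbabilityMeasure μ] {p : ℝ} (hp : 1 ≤ p) {q : ℕ} (hpq : p ≤ q) {f : Ω → ℝ}
    (hf : AEStronglyMeasurable f μ) {K : ℝ≥0} (hK : eLpNorm f q μ ≤ K) {c : ℝ} (hc : 0 < c) :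
    MomentLE μ p (fun ω => c⁻¹ * f ω) (K / c) := by
  have hp0 : 0 < p := by linarith
  have h1 : eLpNorm (fun ω => c⁻¹ * f ω) (ENNReal.ofReal p) μ ≤ ENNReal.ofReal (K / c) := by
    refine (eLpNorm_const_smul_le (c := c⁻¹) (f := f)).trans ?_
    have h2 : eLpNorm f (ENNReal.ofReal p) μ ≤ eLpNorm f q μ :=
      eLpNorm_le_eLpNorm_of_exponent_le (ENNReal.ofReal_le_of_le_toReal (by simpa using hpq)) hf
    rw [div_eq_inv_mul, ENNReal.ofReal_mul (by positivity), Real.enorm_eq_ofReal_abs,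
      abs_of_pos (by positivity), ENNReal.ofReal_coe_nnreal]
    gcongr
    exact h2.trans hK
  have h3 : MemLp (fun ω => c⁻¹ * f ω) (ENNReal.ofReal p) μ :=
    ⟨hf.const_mul _, h1.trans_lt ENNReal.ofReal_lt_top⟩
  refine ⟨h3, ?_⟩
  rw [h3.eLpNorm_eq_integral_rpow_norm (by simpa using hp0) (by simp),
    ENNReal.toReal_ofReal hp0.le] at h1
  simpa [one_div] using (ENNReal.ofReal_le_ofReal_iff (by positivity)).1 h1

lemma Model.Tame.momentLE_partialDeriv {𝔐 : Model.{u} σ C} {B : ℕ → ℕ → ℝ≥0}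
    {h : Config 𝔐.n → ℝ} (hh : 𝔐.Tame B h) {A : 𝔐.Ω → Matrix (Fin 𝔐.n) (Fin 𝔐.n) ℝ}
    (hA : 𝔐.Noise A) {P : List (Fin 𝔐.n × Fin 𝔐.n)} (hP : ∀ e ∈ P, e.1 < e.2) {p : ℝ}
    (hp : 1 ≤ p) :
    MomentLE 𝔐.μ p (fun ω => partialDeriv P (fun X => h (X, 𝔐.u0 ω, 𝔐.Z ω)) (A ω))
      (B ⌈p⌉₊ P.length / (𝔐.n : ℝ) ^ ((P.length : ℝ) / 2)) := by
  have hn : (0 : ℝ) < 𝔐.n := by exact_mod_cast 𝔐.pos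
  have hpos : 0 < √(𝔐.n : ℝ) ^ P.length := by positivity
  have h1 := momentLE_of_eLpNorm_le hp (Nat.le_ceil p)
    (hA.aestronglyMeasurable_comp (contDiff_iterDeriv hh.smooth P))
    ((hh P.length).bound A hA P hP le_rfl ⌈p⌉₊ (Nat.one_le_ceil_iff.2 (by linarith))) hpos
  rw [← sqrt_pow_eq_rpow hn.le]
  convert h1 using 2 with ω
  rw [Model.config, iterDeriv_eq_partialDeriv, inv_mul_cancel_left₀ hpos.ne']

lemma momentLE_rowSum_partialDeriv {𝔐 : Model.{u} σ C} {h : Fin 𝔐.n → Config 𝔐.n → ℝ}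
    {A : 𝔐.Ω → Matrix (Fin 𝔐.n) (Fin 𝔐.n) ℝ} (hA : 𝔐.Noise A) {P : List (Fin 𝔐.n × Fin 𝔐.n)}
    {i : Fin 𝔐.n} {B : ℕ → ℕ → ℝ≥0} (hh : 𝔐.Tame B (rowSum i fun j => iterDeriv P (h j)))
    {p : ℝ} (hp : 1 ≤ p) :
    MomentLE 𝔐.μ p (fun ω => (((√(𝔐.n : ℝ))⁻¹ • A ω) *ᵥ fun j =>
        partialDeriv P (fun X => h j (X, 𝔐.u0 ω, 𝔐.Z ω)) (A ω)) i)
      (B ⌈p⌉₊ 0 / (𝔐.n : ℝ) ^ ((P.length : ℝ) / 2)) := by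
  have hn : (0 : ℝ) < 𝔐.n := by exact_mod_cast 𝔐.pos
  have hpos : 0 < √(𝔐.n : ℝ) ^ P.length := by positivity
  have h1 := momentLE_of_eLpNorm_le hp (Nat.le_ceil p) (hA.aestronglyMeasurable_comp hh.smooth)
    ((hh 0).eLpNorm_le hA (Nat.one_le_ceil_iff.2 (by linarith : 0 < p))) hpos
  rw [← sqrt_pow_eq_rpow hn.le]
  convert h1 using 2 with ω
  rw [Matrix.smul_mulVec, Pi.smul_apply, smul_eq_mul, rowSum, mul_left_comm]
  congr 1
  simp only [Matrix.mulVec, dotProduct, Finset.mul_sum]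
  refine Finset.sum_congr rfl fun j _ => ?_
  rw [Model.config, iterDeriv_eq_partialDeriv, mul_left_comm, inv_mul_cancel_left₀ hpos.ne']

end AMP

end

theorem proposition3 {σ : ℝ} (hσ : 0 < σ) (C : ℝ)
    (F : (k : ℕ) → (Fin (k + 1) → ℝ) → ℝ) (hF : ∀ k, AMP.SmoothBddDeriv (F k))
    (k : ℕ) (p : ℝ) (hp : 1 ≤ p) (m : ℕ) :
    ∃ Γ Γ' Υ : ℝ, ∀ n : ℕ, 2 ≤ n →
      ∀ (Ω : Type*) [MeasurableSpace Ω] (μ : Measure Ω) [IsProbabilityMeasure μ]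
        (u0 : Ω → Fin n → ℝ) (Z : Ω → Matrix (Fin n) (Fin n) ℝ),
        AMP.IsSignal μ σ C u0 Z →
      ∀ A : Ω → Matrix (Fin n) (Fin n) ℝ, AMP.IsNoise μ σ u0 Z A →
      ∀ P : List (Fin n × Fin n), P.length = m → (∀ e ∈ P, e.1 < e.2) →
      ∀ i : Fin n,
        AMP.MomentLE μ p
          (fun ω => AMP.partialDeriv P
            (fun X => AMP.orbit F (Z ω) (u0 ω) X k i) (A ω))
          (Γ / (n : ℝ) ^ ((m : ℝ) / 2)) ∧
        AMP.MomentLE μ p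
          (fun ω => AMP.partialDeriv P
            (fun X => (AMP.hat X (Z ω) *ᵥ AMP.orbit F (Z ω) (u0 ω) X k) i) (A ω))
          (Γ' / (n : ℝ) ^ ((m : ℝ) / 2)) ∧
        AMP.MomentLE μ p
          (fun ω => (((Real.sqrt n)⁻¹ • A ω) *ᵥ
            fun j => AMP.partialDeriv P
              (fun X => AMP.orbit F (Z ω) (u0 ω) X k j) (A ω)) i)
          (Υ / (n : ℝ) ^ ((m : ℝ) / 2)) := by
  obtain ⟨B, hB⟩ := AMP.Model.exists_tame_orbitFn (C := C) hσ hF k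
  obtain ⟨B', hB'⟩ := AMP.Model.exists_tame_hatOrbitFn (C := C) hσ F k B
  -- The third estimate concerns a row sum whose weights are already derivatives of order `m`, hence
  -- the shift by `m`. Only the order-zero bound of this row sum is used.
  obtain ⟨B'', hB''⟩ := AMP.Model.exists_tame_rowSum (σ := σ) (C := C)
    fun p r => B p (r + m)
  refine ⟨B ⌈p⌉₊ m, B' ⌈p⌉₊ m, B'' ⌈p⌉₊ 0, ?_⟩
  intro n hn Ω _ μ _ u0 Z hsig A hA P hPm hP i
  subst hPm
  let 𝔐 : AMP.Model σ C := ⟨n, by omega, Ω, _, μ, inferInstance, u0, Z, hsig⟩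
  have hA' : 𝔐.Noise A := hA
  exact ⟨(hB 𝔐 i).momentLE_partialDeriv hA' hP hp,
    (hB' 𝔐 (hB 𝔐) i).momentLE_partialDeriv hA' hP hp,
    AMP.momentLE_rowSum_partialDeriv hA'
      (hB'' 𝔐 i _ fun j => (hB 𝔐 j).iterDeriv hP) hp⟩
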